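/- **Definitions.** A *commutative regular quasi-semiring* (cr-qsring) is an algebra $(R,+,\bullet,-,{}^{-1},\varepsilon)$ of signature $(2,2,1,1,0)$ such that $(R,+)$ and $(R,\bullet)$ are commutative regular semigroups with quasi-inverses $-x$ and $x^{-1}$ (i.e. $x+(-x)+x=x$, $(-x)+x+(-x)=-x$, and likewise for $\bullet$), such that $\varepsilon$ is the only element idempotent for both operations, and such that, writing $e^+(x)=x+(-x)$ and $x\le y\iff x=y+e^+(x)$, for all $x,y,z\in R$: $x\bullet y+x\bullet z\le x\bullet(y+z)$; $y\le z\Rightarrow x\bullet y\le x\bullet z$; $-(x\bullet y)=x\bullet(-y)$; and $e^+(x+y)\le e^+(x\bullet y)$ whenever $x\bullet x=x$ and $y\bullet y=y$. Let $\Lambda=\{x\in R: x+x=x\}$; it is an Abelian $l$-group under $\bullet$ with neutral element $\varepsilon$, order $\le$ and meet $+$. Put $\Lambda_+=\{\alpha\in\Lambda:\alpha\ge\varepsilon\}$ and $v(x)=\varepsilon\bullet x\in\Lambda$. $R$ is *directed* if $\varepsilon\le x$ whenever $x\bullet x=x$; then any two elements have a meet $x\wedge y=x+v(x-y)$. A directed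 $R$ is *superrigid* if for every $\alpha\in\Lambda_+$ there is a (necessarily unique) $1_\alpha\in R$ with $1_\alpha\bullet 1_\alpha=1_\alpha$ and $e^+(1_\alpha)=\alpha$. $R$ is *complete* if for every $x\in R$ there is a map $\varphi:\Lambda\to R$ with $e^+(\varphi(\alpha))=\alpha$ for all $\alpha$, $\varphi(\alpha)\le\varphi(\beta)$ for $\alpha\le\beta$, and $\varphi(e^+(x))=x$. $\widehat\Lambda$ is the set of maps $\theta:\Lambda_+\to\Lambda$ with $\theta(\alpha)=\theta(\beta)\wedge\alpha$ for $\alpha\le\beta$, ordered pointwise, with last element $\alpha\mapsto\alpha$; it is a commutative monoid under $(\theta\zeta)(\alpha)=\bigl(\theta(\alpha\zeta(\varepsilon)^{-1})\,\zeta(\alpha\theta(\varepsilon)^{-1})\bigr)\wedge\alpha$, and $\Lambda$ is embedded in it by $\gamma\mapsto(\alpha\mapsto\gamma\wedge\alpha)$. For $R$ superrigid and directed, $B=B(R)$ is the set of maps $\varphi:\Lambda_+\to R$ with $e^+(\varphi(\alpha))=\alpha$ and $\varphi(\alpha)\le\varphi(\beta)$ for $\alpha\le\beta$; it is a commutative ring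 under pointwise addition and $(\varphi\cdot\psi)(\alpha)=\varphi(\alpha\bullet v(\psi(\varepsilon))^{-1})\bullet\psi(\alpha\bullet v(\varphi(\varepsilon))^{-1})+\alpha$, with unit $\alpha\mapsto1_\alpha$. Let $w:B\to\widehat\Lambda$, $w(\varphi)=v\circ\varphi$, and let $A=\{\varphi\in B: w(\varphi)\ge\varepsilon\}$, a subring of $B$. Let $M$ be the multiplicative monoid of finitely generated $A$-submodules of $B$, with group of invertible elements $M^*$, and let $\widehat w:M\to\widehat\Lambda$ be given by $\widehat w(I)=\bigwedge_i w(\varphi_i)$ for any finite system of generators $(\varphi_i)$ of $I$ (the value does not depend on the system). $R$ is *Prüfer* if $A\subseteq B$ is a Prüfer extension, i.e. every $I\in M$ with $IB=B$ is invertible. $R$ is *Prüfer–Manis in the strong sense* if it is Prüfer, the group $\widehat w(M)^*$ of invertible elements of the monoid $\widehat w(M)$ equals $\Lambda$, and $\widehat w$ restricts to an isomorphism of ordered groups $M^*\to\Lambda$, where $I\le J\iff J\subseteq I$ on $M^*$. For $R$ directed put $d(x,y)=\dfrac{e^+(x)\bullet e^+(y)}{e^+(x\wedge y)^2}\in\Lambda_+$,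 and let $[x,y]$ be the set of all $z\ge x\wedge y$ such that $z$ is the join of $x\wedge z$ and $y\wedge z$. $R$ is *locally faithfully full* if for all $x,y\in R$ the map $z\mapsto d(x,z)$ is a bijection from $[x,y]$ onto $\{\gamma\in\Lambda:\varepsilon\le\gamma\le d(x,y)\}$, and *median* if for all $x,y,z\in R$ the set $[x,y]\cap[y,z]\cap[z,x]$ consists of a single element. **Lemma 6.11.** Let $R$ be a complete superrigid directed cr-qsring such that for every $\gamma\in\Lambda$ there is $I\in M^*$ with $\widehat w(I)=\gamma$. Then $R$ is Prüfer–Manis in the strong sense and locally faithfully full, and hence median. -/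

import Mathlib

/-! Commutative regular quasi-semirings, their associated ring, and the value map on finitely
generated submodules. -/

namespace CRQ

/-! ### The extension of an Abelian lattice-ordered group to a lattice-ordered monoid -/

/-- The monoid of nonnegative elements `α ≥ 1` of a (multiplicative) Abelian lattice-ordered
group. -/
abbrev Pos (Λ : Type*) [CommGroup Λ] [Lattice Λ] [IsOrderedMonoid Λ] : Type _ :=
  Submonoid.oneLE Λ

/-- The inverse limit of the down-sets of the nonnegative elements, i.e. the set of all maps
`φ : Λ₊ → Λ` with `φ α = φ β ⊓ α` for `α ≤ β`. -/
structure LHat (Λ : Type*) [CommGroup Λ] [Lattice Λ] [IsOrderedMonoid Λ] where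
  /-- the underlying map -/
  toFun : Pos Λ → Λ
  compat' : ∀ α β : Pos Λ, α ≤ β → toFun α = toFun β ⊓ (α : Λ)

namespace LHat

variable {Λ : Type*} [CommGroup Λ] [Lattice Λ] [IsOrderedMonoid Λ]

instance : CoeFun (LHat Λ) (fun _ => Pos Λ → Λ) := ⟨LHat.toFun⟩

theorem ext {φ ψ : LHat Λ} (h : ∀ α, φ α = ψ α) : φ = ψ := by
  cases φ; cases ψ; congr; exact funext h

theorem compat (φ : LHat Λ) {α β : Pos Λ} (h : α ≤ β) : φ α = φ β ⊓ (α : Λ) :=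
  φ.compat' α β h

theorem mono (φ : LHat Λ) {α β : Pos Λ} (h : α ≤ β) : φ α ≤ φ β := by
  rw [φ.compat h]; exact inf_le_left

theorem le_self (φ : LHat Λ) (α : Pos Λ) : φ α ≤ (α : Λ) := by
  rw [φ.compat le_rfl]; exact inf_le_right

theorem one_le (α : Pos Λ) : (1 : Pos Λ) ≤ α := α.2

/-- The element `φ₋ = (φ 1)⁻¹` of `Λ₊`. -/
def minus (φ : LHat Λ) : Pos Λ :=
  ⟨(φ 1)⁻¹, by
    have h := φ.le_self 1
    simpa using h⟩

/-- The pointwise partial order. -/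
instance : PartialOrder (LHat Λ) where
  le φ ψ := ∀ α, φ α ≤ ψ α
  le_refl φ α := le_rfl
  le_trans φ ψ χ h₁ h₂ α := (h₁ α).trans (h₂ α)
  le_antisymm φ ψ h₁ h₂ := ext fun α => le_antisymm (h₁ α) (h₂ α)

theorem le_def {φ ψ : LHat Λ} : φ ≤ ψ ↔ ∀ α, φ α ≤ ψ α := Iff.rfl

/-- The pointwise meet. -/
instance : SemilatticeInf (LHat Λ) where
  inf φ ψ := ⟨fun α => φ α ⊓ ψ α, fun α β h => by
    show φ α ⊓ ψ α = φ β ⊓ ψ β ⊓ (α : Λ)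
    rw [φ.compat h, ψ.compat h, inf_inf_inf_comm, inf_idem]⟩
  inf_le_left φ ψ := fun _ => inf_le_left
  inf_le_right φ ψ := fun _ => inf_le_right
  le_inf φ ψ χ h₁ h₂ := fun α => le_inf (h₁ α) (h₂ α)

theorem inf_apply (φ ψ : LHat Λ) (α : Pos Λ) : (φ ⊓ ψ) α = φ α ⊓ ψ α := rfl

/-- The last element, given by the inclusion `Λ₊ → Λ`. -/
instance : OrderTop (LHat Λ) where
  top := ⟨fun α => (α : Λ), fun _ _ h => (inf_eq_right.2 h).symm⟩
  le_top φ := fun α => φ.le_self α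

theorem top_apply (α : Pos Λ) : (⊤ : LHat Λ) α = (α : Λ) := rfl

/-- The embedding of `Λ`, sending `γ` to `α ↦ γ ⊓ α`. -/
def embed (γ : Λ) : LHat Λ :=
  ⟨fun α => γ ⊓ (α : Λ), fun α β h => by
    rw [inf_assoc, inf_eq_right.2 (show (α : Λ) ≤ β from h)]⟩

theorem mul_aux (φ ψ : LHat Λ) (α γ : Pos Λ) (h₁ : α * ψ.minus ≤ γ) (h₂ : α * φ.minus ≤ γ) :
    (φ (α * ψ.minus) * ψ (α * φ.minus)) ⊓ (α : Λ) = (φ γ * ψ γ) ⊓ (α : Λ) := by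
  apply le_antisymm
  · exact inf_le_inf_right _ (mul_le_mul' (φ.mono h₁) (ψ.mono h₂))
  · refine le_inf ?_ inf_le_right
    rw [φ.compat h₁, ψ.compat h₂, mul_inf, inf_mul, inf_mul]
    have e1 : φ 1 ≤ φ γ := φ.mono (one_le γ)
    have e2 : ψ 1 ≤ ψ γ := ψ.mono (one_le γ)
    have m1 : ((φ.minus : Pos Λ) : Λ) = (φ 1)⁻¹ := rfl
    have m2 : ((ψ.minus : Pos Λ) : Λ) = (ψ 1)⁻¹ := rfl
    simp only [Submonoid.coe_mul, m1, m2]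
    have f1 : (1 : Λ) ≤ φ γ * (φ 1)⁻¹ := by rwa [← div_eq_mul_inv, one_le_div']
    have f2 : (1 : Λ) ≤ (ψ 1)⁻¹ * ψ γ := by
      rw [mul_comm]; rwa [← div_eq_mul_inv, one_le_div']
    have g1 : (1 : Λ) ≤ (φ 1)⁻¹ := φ.minus.2
    have g2 : (1 : Λ) ≤ (ψ 1)⁻¹ := ψ.minus.2
    have ha : (1 : Λ) ≤ (α : Λ) := α.2
    refine le_inf (le_inf inf_le_left ?_) (le_inf ?_ ?_)
    · refine inf_le_right.trans ?_
      rw [mul_assoc]; exact le_mul_of_one_le_right' f2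
    · refine inf_le_right.trans ?_
      rw [mul_left_comm]; exact le_mul_of_one_le_right' f1
    · refine inf_le_right.trans ?_
      calc (α : Λ) ≤ α * ((ψ 1)⁻¹ * (α * (φ 1)⁻¹)) :=
            le_mul_of_one_le_right' (one_le_mul g2 (one_le_mul ha g1))
        _ = α * (ψ 1)⁻¹ * (α * (φ 1)⁻¹) := by rw [mul_assoc]

/-- The product `(φ ψ) α = φ (α ψ₋) ψ (α φ₋) ⊓ α`. -/
instance : Mul (LHat Λ) where
  mul φ ψ := ⟨fun α => (φ (α * ψ.minus) * ψ (α * φ.minus)) ⊓ (α : Λ), fun α β h => by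
    have k1 : ∀ x : Pos Λ, α * x ≤ β * x := fun x => mul_le_mul_left h x
    have k2 : β * ψ.minus ≤ β * ψ.minus * φ.minus := le_mul_of_one_le_right' (one_le _)
    have k3 : β * φ.minus ≤ β * ψ.minus * φ.minus := by
      rw [mul_right_comm]; exact le_mul_of_one_le_right' (one_le _)
    rw [mul_aux φ ψ α (β * ψ.minus * φ.minus) ((k1 _).trans k2) ((k1 _).trans k3),
      mul_aux φ ψ β (β * ψ.minus * φ.minus) k2 k3, inf_assoc,
      inf_eq_right.2 (show (α : Λ) ≤ β from h)]⟩

theorem mul_apply (φ ψ : LHat Λ) (α γ : Pos Λ) (h₁ : α * ψ.minus ≤ γ) (h₂ : α * φ.minus ≤ γ) :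
    (φ * ψ) α = (φ γ * ψ γ) ⊓ (α : Λ) := mul_aux φ ψ α γ h₁ h₂

theorem mul_apply' (φ ψ : LHat Λ) (α : Pos Λ) :
    ∃ γ₀ : Pos Λ, α ≤ γ₀ ∧ ∀ γ, γ₀ ≤ γ → (φ * ψ) α = (φ γ * ψ γ) ⊓ (α : Λ) := by
  refine ⟨α * ψ.minus * φ.minus, ?_, fun γ h => mul_apply φ ψ α γ ?_ ?_⟩
  · exact (le_mul_of_one_le_right' (one_le _)).trans (le_mul_of_one_le_right' (one_le _))
  · exact (le_mul_of_one_le_right' (one_le _)).trans h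
  · rw [mul_right_comm] at h
    exact (le_mul_of_one_le_right' (one_le _)).trans h

protected theorem mul_comm (φ ψ : LHat Λ) : φ * ψ = ψ * φ := by
  apply ext; intro α
  obtain ⟨γ₁, -, h₁⟩ := mul_apply' φ ψ α
  obtain ⟨γ₂, -, h₂⟩ := mul_apply' ψ φ α
  rw [h₁ (γ₁ * γ₂) (le_mul_of_one_le_right' (one_le _)),
    h₂ (γ₁ * γ₂) (le_mul_of_one_le_left' (one_le _)), mul_comm (φ _)]

theorem mul_mul_apply (φ ψ χ : LHat Λ) (α : Pos Λ) :
    ∃ γ₀ : Pos Λ, ∀ γ, γ₀ ≤ γ → (φ * ψ * χ) α = (φ γ * ψ γ * χ γ) ⊓ (α : Λ) := by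
  obtain ⟨η, hη⟩ : ∃ η, η = α * χ.minus * (φ * ψ).minus := ⟨_, rfl⟩
  have h5 : α * χ.minus ≤ η := hη ▸ le_mul_of_one_le_right' (one_le _)
  have h6 : α * (φ * ψ).minus ≤ η := by
    rw [hη, mul_right_comm]; exact le_mul_of_one_le_right' (one_le _)
  obtain ⟨δ, hδ, h₂⟩ := mul_apply' φ ψ η
  refine ⟨δ, fun γ hγ => ?_⟩
  have h7 : (φ * ψ) η = φ γ * ψ γ ⊓ (η : Λ) := h₂ γ hγ
  rw [mul_apply (φ * ψ) χ α η h5 h6]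
  have hq : (α : Λ) ≤ χ η * η := by
    have q2 : (α : Λ) * (χ 1)⁻¹ ≤ η := h5
    calc (α : Λ) = χ 1 * (α * (χ 1)⁻¹) := by rw [mul_left_comm]; simp
      _ ≤ χ η * η := mul_le_mul' (χ.mono (one_le _)) q2
  have hr : (α : Λ) ≤ (φ * ψ) η * η := by
    have q2 : (α : Λ) * ((φ * ψ) 1)⁻¹ ≤ η := h6
    calc (α : Λ) = (φ * ψ) 1 * (α * ((φ * ψ) 1)⁻¹) := by rw [mul_left_comm]; simp
      _ ≤ (φ * ψ) η * η := mul_le_mul' ((φ * ψ).mono (one_le _)) q2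
  have hη' : χ η = χ γ ⊓ (η : Λ) := χ.compat (hδ.trans hγ)
  apply le_antisymm
  · refine inf_le_inf_right _ (mul_le_mul' ?_ ?_)
    · rw [h7]; exact inf_le_left
    · rw [hη']; exact inf_le_left
  · refine le_inf ?_ inf_le_right
    rw [h7, inf_mul]
    refine le_inf ?_ ?_
    · rw [hη', mul_inf]
      refine le_inf inf_le_left (inf_le_right.trans (hr.trans ?_))
      rw [h7]
      exact mul_le_mul_left inf_le_left _
    · rw [mul_comm (η : Λ)]; exact inf_le_right.trans hq

/-- The commutative monoid structure; the neutral element is the image of `1 ∈ Λ`. -/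
instance : CommMonoid (LHat Λ) where
  one := embed 1
  mul_comm := LHat.mul_comm
  mul_assoc φ ψ χ := by
    apply ext; intro α
    obtain ⟨γ₁, h₁⟩ := mul_mul_apply φ ψ χ α
    obtain ⟨γ₂, h₂⟩ := mul_mul_apply ψ χ φ α
    rw [LHat.mul_comm φ (ψ * χ), h₁ (γ₁ * γ₂) (le_mul_of_one_le_right' (one_le _)),
      h₂ (γ₁ * γ₂) (le_mul_of_one_le_left' (one_le _)), mul_assoc, mul_comm (φ _)]
  one_mul φ := by
    apply ext; intro α
    obtain ⟨γ, hγ, h⟩ := mul_apply' (embed 1) φ α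
    have e : ((embed 1 : LHat Λ) * φ) α = (embed 1 : LHat Λ) γ * φ γ ⊓ (α : Λ) := h γ le_rfl
    have e1 : (embed 1 : LHat Λ) γ = 1 := inf_eq_left.2 γ.2
    rw [e1, one_mul, ← φ.compat hγ] at e
    exact e
  mul_one φ := by
    rw [LHat.mul_comm]
    apply ext; intro α
    obtain ⟨γ, hγ, h⟩ := mul_apply' (embed 1) φ α
    have e : ((embed 1 : LHat Λ) * φ) α = (embed 1 : LHat Λ) γ * φ γ ⊓ (α : Λ) := h γ le_rfl
    have e1 : (embed 1 : LHat Λ) γ = 1 := inf_eq_left.2 γ.2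
    rw [e1, one_mul, ← φ.compat hγ] at e
    exact e

end LHat

/-! ### Commutative regular quasi-semirings -/

/-- The canonical partial order of a commutative regular additive semigroup:
`x ≤ y` if and only if `x = y + (x + (-x))`. -/
def CanonLE {R : Type*} [Add R] [Neg R] (x y : R) : Prop := x = y + (x + -x)

/-- Commutative regular quasi-semirings. -/
class CRQSRing (R : Type*) extends AddCommSemigroup R, CommSemigroup R, Neg R, Inv R where
  /-- the distinguished constant (it is not a unit for the multiplication) -/
  eps : R
  add_neg_add : ∀ x : R, x + -x + x = x
  neg_add_neg : ∀ x : R, -x + x + -x = -x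
  mul_inv_mul : ∀ x : R, x * x⁻¹ * x = x
  inv_mul_inv : ∀ x : R, x⁻¹ * x * x⁻¹ = x⁻¹
  idem_iff : ∀ x : R, (x + x = x ∧ x * x = x) ↔ x = eps
  quasidistrib : ∀ x y z : R, CanonLE (x * y + x * z) (x * (y + z))
  mul_canon : ∀ x y z : R, CanonLE y z → CanonLE (x * y) (x * z)
  neg_mul' : ∀ x y : R, -(x * y) = x * -y
  canon_mul : ∀ x y : R, x * x = x → y * y = y → CanonLE ((x + y) + -(x + y)) (x * y + -(x * y))

open CRQSRing

section basic

variable {R : Type*} [CRQSRing R]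

theorem add_quasi_unique {x a b : R} (h1 : x + a + x = x) (h2 : a + x + a = a)
    (h3 : x + b + x = x) (h4 : b + x + b = b) : a = b := by
  have e1 : a = a + x + b := by
    calc a = a + x + a := h2.symm
      _ = a + (x + b + x) + a := by rw [h3]
      _ = (a + x + a) + x + b := by ac_rfl
      _ = a + x + b := by rw [h2]
  have e2 : b = a + x + b := by
    calc b = b + x + b := h4.symm
      _ = b + (x + a + x) + b := by rw [h1]
      _ = a + x + (b + x + b) := by ac_rfl
      _ = a + x + b := by rw [h4]
  exact e1.trans e2.symm

theorem mul_quasi_unique {x a b : R} (h1 : x * a * x = x) (h2 : a * x * a = a)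
    (h3 : x * b * x = x) (h4 : b * x * b = b) : a = b := by
  have e1 : a = a * x * b := by
    calc a = a * x * a := h2.symm
      _ = a * (x * b * x) * a := by rw [h3]
      _ = (a * x * a) * x * b := by ac_rfl
      _ = a * x * b := by rw [h2]
  have e2 : b = a * x * b := by
    calc b = b * x * b := h4.symm
      _ = b * (x * a * x) * b := by rw [h1]
      _ = a * x * (b * x * b) := by ac_rfl
      _ = a * x * b := by rw [h4]
  exact e1.trans e2.symm

theorem neg_eq_of {x a : R} (h1 : x + a + x = x) (h2 : a + x + a = a) : -x = a :=
  add_quasi_unique (add_neg_add x) (neg_add_neg x) h1 h2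

theorem inv_eq_of {x a : R} (h1 : x * a * x = x) (h2 : a * x * a = a) : x⁻¹ = a :=
  mul_quasi_unique (mul_inv_mul x) (inv_mul_inv x) h1 h2

theorem neg_of_idem {x : R} (h : x + x = x) : -x = x := neg_eq_of (by rw [h, h]) (by rw [h, h])

theorem inv_of_idem {x : R} (h : x * x = x) : x⁻¹ = x := inv_eq_of (by rw [h, h]) (by rw [h, h])

theorem nneg (x : R) : - -x = x := neg_eq_of (neg_add_neg x) (add_neg_add x)

theorem iinv (x : R) : (x⁻¹)⁻¹ = x := inv_eq_of (inv_mul_inv x) (mul_inv_mul x)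

theorem neg_add' (x y : R) : -(x + y) = -x + -y := by
  apply neg_eq_of
  · calc x + y + (-x + -y) + (x + y) = (x + -x + x) + (y + -y + y) := by ac_rfl
      _ = x + y := by rw [add_neg_add, add_neg_add]
  · calc -x + -y + (x + y) + (-x + -y) = (-x + x + -x) + (-y + y + -y) := by ac_rfl
      _ = -x + -y := by rw [neg_add_neg, neg_add_neg]

theorem inv_mul' (x y : R) : (x * y)⁻¹ = x⁻¹ * y⁻¹ := by
  apply inv_eq_of
  · calc x * y * (x⁻¹ * y⁻¹) * (x * y) = (x * x⁻¹ * x) * (y * y⁻¹ * y) := by ac_rfl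
      _ = x * y := by rw [mul_inv_mul, mul_inv_mul]
  · calc x⁻¹ * y⁻¹ * (x * y) * (x⁻¹ * y⁻¹) = (x⁻¹ * x * x⁻¹) * (y⁻¹ * y * y⁻¹) := by ac_rfl
      _ = x⁻¹ * y⁻¹ := by rw [inv_mul_inv, inv_mul_inv]

theorem e_idem (x : R) : (x + -x) + (x + -x) = x + -x := by
  rw [← add_assoc, add_neg_add]

theorem e_add (x y : R) : (x + y) + -(x + y) = (x + -x) + (y + -y) := by
  rw [neg_add']; ac_rfl

theorem e_of_idem {x : R} (h : x + x = x) : x + -x = x := by rw [neg_of_idem h, h]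

theorem eb_idem (x : R) : (x * x⁻¹) * (x * x⁻¹) = x * x⁻¹ := by
  rw [← mul_assoc, mul_inv_mul]

theorem self_add_e (x : R) : x + (x + -x) = x := by
  rw [add_comm, add_neg_add]

theorem self_mul_eb (x : R) : x * (x * x⁻¹) = x := by
  rw [mul_comm, mul_inv_mul]

instance instPartialOrder : PartialOrder R where
  le := CanonLE
  le_refl x := (self_add_e x).symm
  le_trans x y z (h1 : x = _) (h2 : y = _) := show x = _ by
    have h3 : x + -x = (y + -y) + (x + -x) := by
      conv_lhs => rw [h1]
      rw [e_add, e_of_idem (e_idem x)]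
    calc x = y + (x + -x) := h1
      _ = z + (y + -y) + (x + -x) := by rw [← h2]
      _ = z + (x + -x) := by rw [add_assoc, ← h3]
  le_antisymm x y (h1 : x = _) (h2 : y = _) := by
    have h3 : x + -x = (y + -y) + (x + -x) := by
      conv_lhs => rw [h1]
      rw [e_add, e_of_idem (e_idem x)]
    have h4 : y + -y = (x + -x) + (y + -y) := by
      conv_lhs => rw [h2]
      rw [e_add, e_of_idem (e_idem y)]
    have h5 : x + -x = y + -y := by rw [h3, add_comm, ← h4]
    rw [h1, h5, self_add_e]

theorem qle_def {x y : R} : x ≤ y ↔ x = y + (x + -x) := Iff.rfl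

theorem qmul_le_mul_left (x : R) {y z : R} (h : y ≤ z) : x * y ≤ x * z := mul_canon x y z h

theorem qmul_le_mul {x x' y y' : R} (h : x ≤ x') (h' : y ≤ y') : x * y ≤ x' * y' := by
  refine (qmul_le_mul_left x h').trans ?_
  rw [mul_comm x, mul_comm x']
  exact qmul_le_mul_left y' h

theorem qadd_le_add {x x' y y' : R} (h : x ≤ x') (h' : y ≤ y') : x + y ≤ x' + y' := by
  rw [qle_def] at *
  rw [e_add]
  calc x + y = (x' + (x + -x)) + (y' + (y + -y)) := by rw [← h, ← h']
    _ = _ := by ac_rfl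

theorem qneg_le_neg {x y : R} (h : x ≤ y) : -x ≤ -y := by
  rw [qle_def] at *
  rw [nneg, add_comm (-x) x]
  conv_lhs => rw [h, neg_add', neg_of_idem (e_idem x)]

theorem add_idem_le (x : R) {f : R} (h : f + f = f) : x + f ≤ x := by
  rw [qle_def, e_add, e_of_idem h, ← add_assoc, self_add_e]

theorem mul_idem {f : R} (x : R) (h : f + f = f) : x * f + x * f = x * f := by
  have h1 := quasidistrib x f f
  rw [h] at h1
  have h2 : x * f + x * f = x * f + ((x * f + x * f) + -(x * f + x * f)) := h1
  rwa [e_add, e_idem, self_add_e] at h2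

theorem eps_add_eps : (eps : R) + eps = eps := ((idem_iff eps).2 rfl).1

theorem eps_mul_eps : (eps : R) * eps = eps := ((idem_iff eps).2 rfl).2

theorem eb_of_idem {f : R} (h : f + f = f) : f * f⁻¹ = eps :=
  (idem_iff _).1 ⟨by rw [mul_comm]; exact mul_idem _ h, eb_idem f⟩

theorem eps_mul_idem {f : R} (h : f + f = f) : eps * f = f := by
  rw [← eb_of_idem h, mul_inv_mul]

theorem inv_idem {f : R} (h : f + f = f) : f⁻¹ + f⁻¹ = f⁻¹ := by
  have e : f⁻¹ * eps = f⁻¹ := by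
    rw [← eb_of_idem h, ← mul_assoc, inv_mul_inv]
  rw [← e]; exact mul_idem _ eps_add_eps

theorem idem_le_iff {f g : R} (hf : f + f = f) : f ≤ g ↔ f = g + f := by
  rw [qle_def, e_of_idem hf]

theorem mul_add_idem (x : R) {f g : R} (hf : f + f = f) (hg : g + g = g) :
    x * (f + g) = x * f + x * g := by
  have hfg : (f + g) + (f + g) = f + g := by rw [add_add_add_comm, hf, hg]
  apply le_antisymm
  · have h1 : x * (f + g) ≤ x * f := qmul_le_mul_left x (add_idem_le f hg)
    have h2 : x * (f + g) ≤ x * g := qmul_le_mul_left x (by rw [add_comm]; exact add_idem_le g hf)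
    have h3 := qadd_le_add h1 h2
    rwa [mul_idem x hfg] at h3
  · exact quasidistrib x f g

end basic

/-! ### The lattice-ordered group of additive idempotents -/

/-- The set of additive idempotents `x + x = x`. -/
def Lam (R : Type*) [CRQSRing R] : Type _ := {x : R // x + x = x}

namespace Lam

variable {R : Type*} [CRQSRing R]

instance : CoeOut (Lam R) R := ⟨Subtype.val⟩

theorem coe_inj {a b : Lam R} (h : (a : R) = b) : a = b := Subtype.ext h

theorem idem (a : Lam R) : (a : R) + a = a := a.2

/-- The group operation is the multiplication of `R`, the neutral element is `eps`. -/
instance : CommGroup (Lam R) where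
  mul a b := ⟨(a : R) * b, mul_idem _ b.2⟩
  one := ⟨eps, eps_add_eps⟩
  inv a := ⟨(a : R)⁻¹, inv_idem a.2⟩
  mul_assoc a b c := coe_inj (mul_assoc (a : R) b c)
  mul_comm a b := coe_inj (mul_comm (a : R) b)
  one_mul a := coe_inj (eps_mul_idem a.2)
  mul_one a := coe_inj ((mul_comm (a : R) eps).trans (eps_mul_idem a.2))
  inv_mul_cancel a := coe_inj ((mul_comm (a : R)⁻¹ a).trans (eb_of_idem a.2))

theorem coe_mul (a b : Lam R) : ((a * b : Lam R) : R) = a * b := rfl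
theorem coe_one : ((1 : Lam R) : R) = eps := rfl
theorem coe_inv (a : Lam R) : ((a⁻¹ : Lam R) : R) = (a : R)⁻¹ := rfl

/-- The order is induced by the canonical order of `R`. -/
instance : PartialOrder (Lam R) where
  le a b := (a : R) ≤ b
  le_refl a := le_refl (a : R)
  le_trans a b c := le_trans (a := (a : R))
  le_antisymm a b h1 h2 := coe_inj (le_antisymm h1 h2)

theorem coe_le {a b : Lam R} : (a : R) ≤ b ↔ a ≤ b := Iff.rfl

instance : IsOrderedMonoid (Lam R) where
  mul_le_mul_left a b h c := show (a : R) * c ≤ b * c from qmul_le_mul h le_rfl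

/-- The meet is the addition of `R`; the join is obtained from it by inversion. -/
instance : Lattice (Lam R) :=
  let add : Lam R → Lam R → Lam R := fun a b =>
    ⟨(a : R) + b, by rw [add_add_add_comm, a.2, b.2]⟩
  have l1 : ∀ a b, add a b ≤ a := fun a b => add_idem_le (a : R) b.2
  have l2 : ∀ a b, add a b ≤ b := fun a b => by
    show (a : R) + b ≤ b
    rw [add_comm]; exact add_idem_le (b : R) a.2
  have l3 : ∀ a b c, a ≤ b → a ≤ c → a ≤ add b c := fun a b c h1 h2 => by
    have h3 := qadd_le_add (coe_le.2 h1) (coe_le.2 h2)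
    rw [a.2] at h3
    exact h3
  { inf := add
    sup := fun a b => (add a⁻¹ b⁻¹)⁻¹
    inf_le_left := l1
    inf_le_right := l2
    le_inf := l3
    le_sup_left := fun a b => by rw [le_inv']; exact l1 _ _
    le_sup_right := fun a b => by rw [le_inv']; exact l2 _ _
    sup_le := fun a b c h1 h2 => by
      rw [inv_le']; exact l3 _ _ _ (inv_le_inv_iff.2 h1) (inv_le_inv_iff.2 h2) }

theorem coe_inf (a b : Lam R) : ((a ⊓ b : Lam R) : R) = a + b := rfl

end Lam

section maps

variable {R : Type*} [CRQSRing R]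

/-- The map `e⁺ : x ↦ x + (-x)`. -/
def ep (x : R) : Lam R := ⟨x + -x, e_idem x⟩

/-- The quasivaluation `v : x ↦ eps * x`. -/
def v (x : R) : Lam R := ⟨eps * x, by rw [mul_comm]; exact mul_idem x eps_add_eps⟩

theorem coe_ep (x : R) : (ep x : R) = x + -x := rfl

theorem coe_v (x : R) : (v x : R) = eps * x := rfl

theorem ep_coe (a : Lam R) : ep (a : R) = a := Lam.coe_inj (e_of_idem a.2)

theorem v_coe (a : Lam R) : v (a : R) = a := Lam.coe_inj (eps_mul_idem a.2)

theorem self_add_ep (x : R) : x + (ep x : R) = x := self_add_e x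

theorem ep_add (x y : R) : ep (x + y) = ep x ⊓ ep y := Lam.coe_inj (e_add x y)

theorem ep_neg (x : R) : ep (-x) = ep x := Lam.coe_inj (by
  rw [coe_ep, coe_ep, nneg, add_comm])

theorem le_iff {x y : R} : x ≤ y ↔ x = y + (ep x : R) := Iff.rfl

theorem ep_mono {x y : R} (h : x ≤ y) : ep x ≤ ep y := by
  rw [le_iff] at h
  rw [h, ep_add]; exact inf_le_left

theorem eq_of_le {x y : R} (h : x ≤ y) (h' : ep y ≤ ep x) : x = y := by
  have e : ep x = ep y := le_antisymm (ep_mono h) h'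
  rw [le_iff] at h
  rw [h, e, self_add_ep]

theorem v_mul (x y : R) : v (x * y) = v x * v y := Lam.coe_inj (by
  rw [Lam.coe_mul, coe_v, coe_v, coe_v, mul_mul_mul_comm, eps_mul_eps])

theorem v_mono {x y : R} (h : x ≤ y) : v x ≤ v y := qmul_le_mul_left eps h

theorem v_add (x y : R) : v x ⊓ v y ≤ v (x + y) := quasidistrib eps x y

theorem v_neg (x : R) : v (-x) = v x := Lam.coe_inj (by
  rw [coe_v, coe_v, ← neg_mul', neg_of_idem]
  exact (v x).2)

theorem v_le_ep (x : R) : v x ≤ ep x := by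
  have h := v_add x (-x)
  rw [v_neg, inf_idem] at h
  rwa [← v_coe (ep x)]

theorem v_eps : v (eps : R) = 1 := Lam.coe_inj eps_mul_eps

theorem ep_eps : ep (eps : R) = 1 := ep_coe (1 : Lam R)

theorem mul_lam (x : R) (a : Lam R) : x * (a : R) = ((v x * a : Lam R) : R) := by
  conv_lhs => rw [← eps_mul_idem a.2]
  rw [Lam.coe_mul, coe_v, ← mul_assoc, mul_comm x]

theorem v_of_mul_idem {x : R} (h : x * x = x) : v x = 1 := by
  have : v x * v x = v x := by rw [← v_mul, h]
  simpa using this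

theorem v_eb (x : R) : v (x * x⁻¹) = 1 := v_of_mul_idem (eb_idem x)

theorem v_inv (x : R) : v x⁻¹ = (v x)⁻¹ := by
  have h := v_eb x
  rw [v_mul] at h
  exact eq_inv_of_mul_eq_one_right h

theorem ep_eq (x : R) : ep x = v x * ep (x * x⁻¹) := by
  apply le_antisymm
  · have h := quasidistrib x (x * x⁻¹) (-(x * x⁻¹))
    rw [← neg_mul', self_mul_eb] at h
    have e := mul_lam x (ep (x * x⁻¹))
    rw [coe_ep] at e
    rw [e] at h
    exact h
  · have h := quasidistrib x⁻¹ x (-x)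
    rw [← neg_mul', mul_comm x⁻¹ x] at h
    have e := mul_lam x⁻¹ (ep x)
    rw [coe_ep] at e
    rw [e] at h
    have h' : ep (x * x⁻¹) ≤ v x⁻¹ * ep x := h
    rw [v_inv] at h'
    calc v x * ep (x * x⁻¹) ≤ v x * ((v x)⁻¹ * ep x) := mul_le_mul_right h' _
      _ = ep x := by simp

theorem ep_mul_eb {x y : R} (hx : x * x = x) (hy : y * y = y) : ep (x * y) = ep x ⊓ ep y := by
  have key : ∀ {x y : R}, x * x = x → ep (x * y) ≤ ep y := by
    intro x y hx
    have h := quasidistrib x y (-y)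
    rw [← neg_mul'] at h
    have e := mul_lam x (ep y)
    rw [coe_ep] at e
    rw [e, v_of_mul_idem hx, one_mul] at h
    exact h
  apply le_antisymm
  · refine le_inf ?_ (key hx)
    rw [mul_comm]; exact key hy
  · rw [← ep_add]; exact canon_mul x y hx hy

theorem ep_mul (x y : R) : ep (x * y) = (v x * ep y) ⊓ (v y * ep x) := by
  have e : x * y * (x * y)⁻¹ = (x * x⁻¹) * (y * y⁻¹) := by rw [inv_mul']; ac_rfl
  rw [ep_eq (x * y), e, ep_mul_eb (eb_idem x) (eb_idem y), v_mul, mul_inf, ep_eq y, ep_eq x,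
    inf_comm]
  congr 1
  · rw [mul_assoc]
  · rw [mul_assoc, mul_left_comm]

theorem add_lam_eq {x y : R} {a : Lam R} (h : x ≤ y) (ha : a ≤ ep x) :
    x + (a : R) = y + (a : R) := by
  refine eq_of_le (qadd_le_add h le_rfl) ?_
  rw [ep_add, ep_add, ep_coe]
  exact le_inf (inf_le_right.trans ha) inf_le_right

theorem add_lam_le (x : R) (a : Lam R) : x + (a : R) ≤ x := add_idem_le x a.2

theorem v_add_lam (x : R) (a : Lam R) : v (x + (a : R)) = v x ⊓ a := by
  apply le_antisymm
  · refine le_inf (v_mono (add_lam_le x a)) ((v_le_ep _).trans ?_)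
    rw [ep_add, ep_coe]; exact inf_le_right
  · have := v_add x (a : R)
    rwa [v_coe] at this

theorem le_add_v_sub {x y u : R} (h1 : u ≤ x) (h2 : u ≤ y) : u ≤ x + (v (x + -y) : R) := by
  have h3 : (ep u : R) ≤ x + -y := qadd_le_add h1 (qneg_le_neg h2)
  have h4 := v_mono h3
  rw [v_coe] at h4
  rw [← self_add_ep u]
  exact qadd_le_add h1 h4

end maps

/-! ### Directed and superrigid quasi-semirings -/

/-- `R` is directed if `eps ≤ x` for all multiplicative idempotents `x`. -/
class IsDirectedQS (R : Type*) [CRQSRing R] : Prop where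
  eps_le : ∀ x : R, x * x = x → eps ≤ x

/-- `R` is superrigid if it is directed and `e⁺`, restricted to the multiplicative idempotents, is
surjective onto the nonnegative elements of `Lam R`. -/
class IsSuperrigid (R : Type*) [CRQSRing R] : Prop extends IsDirectedQS R where
  exists_idem : ∀ α : Pos (Lam R), ∃ x : R, x * x = x ∧ ep x = (α : Lam R)

section directed

variable {R : Type*} [CRQSRing R] [IsDirectedQS R]

theorem v_le (x : R) : (v x : R) ≤ x := by
  have h := qmul_le_mul_left x (IsDirectedQS.eps_le (x * x⁻¹) (eb_idem x))
  rw [self_mul_eb, mul_comm] at h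
  exact h

theorem add_v_sub (x y : R) : x + (v (x + -y) : R) = y + (v (x + -y) : R) := by
  have h : (v (x + -y) : R) ≤ x + -y := v_le _
  have hle : v (x + -y) ≤ ep x := by
    refine (v_le_ep _).trans ?_
    rw [ep_add]; exact inf_le_left
  rw [le_iff, ep_coe] at h
  have e1 : y + (v (x + -y) : R) = x + (ep y : R) + (v (x + -y) : R) := by
    conv_lhs => rw [h]
    rw [coe_ep]; ac_rfl
  rw [e1, add_assoc, ← Lam.coe_inf, inf_eq_right.2]
  refine (v_le_ep _).trans ?_
  rw [ep_add, ep_neg]; exact inf_le_right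

/-- In the directed case every pair has a meet, namely `x + v (x - y)`. -/
instance instSemilatticeInf : SemilatticeInf R where
  inf x y := x + (v (x + -y) : R)
  inf_le_left x y := add_lam_le _ _
  inf_le_right x y := by
    show x + (v (x + -y) : R) ≤ y
    rw [add_v_sub]; exact add_lam_le _ _
  le_inf u x y h1 h2 := le_add_v_sub h1 h2

theorem inf_def (x y : R) : x ⊓ y = x + (v (x + -y) : R) := rfl

theorem qmul_inf (x y z : R) : x * (y ⊓ z) = (x * y) ⊓ (x * z) := by
  apply le_antisymm
  · exact le_inf (qmul_le_mul_left x inf_le_left) (qmul_le_mul_left x inf_le_right)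
  · have h1 : x * y + -(x * z) ≤ x * (y + -z) := by
      rw [neg_mul']; exact quasidistrib x y (-z)
    have h2 : (v (x * y + -(x * z)) : R) ≤ x * (v (y + -z) : R) := by
      rw [mul_lam, ← v_mul]
      exact v_mono h1
    exact (qadd_le_add le_rfl h2).trans (quasidistrib x y _)

theorem idem_le_of_ep_le {x y : R} (hx : x * x = x) (hy : y * y = y) (h : ep x ≤ ep y) :
    x ≤ y := by
  obtain ⟨m, hm⟩ : ∃ m, m = x ⊓ y := ⟨_, rfl⟩
  have mx : m ≤ x := hm ▸ inf_le_left
  have my : m ≤ y := hm ▸ inf_le_right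
  have em : eps ≤ m := by
    rw [hm]; exact le_inf (IsDirectedQS.eps_le x hx) (IsDirectedQS.eps_le y hy)
  have vm : v m = 1 := by
    apply le_antisymm
    · have := v_mono mx
      rwa [v_of_mul_idem hx] at this
    · have := v_mono em
      rwa [v_eps] at this
  have mm : m * m ≤ x * y := qmul_le_mul mx my
  have mm' : m * m = m := by
    have h1 : m * m ≤ m := by
      rw [hm]
      refine le_inf ?_ ?_
      · have := qmul_le_mul (inf_le_left : x ⊓ y ≤ x) (inf_le_left : x ⊓ y ≤ x)
        rwa [hx] at this
      · have := qmul_le_mul (inf_le_right : x ⊓ y ≤ y) (inf_le_right : x ⊓ y ≤ y)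
        rwa [hy] at this
    refine eq_of_le h1 ?_
    rw [ep_mul, vm, one_mul, inf_idem]
  have e1 : x * y * m = x * y := by
    rw [hm, qmul_inf, mul_assoc x y y, hy, mul_comm x y, mul_assoc y x x, hx, inf_idem]
  have hxy : (x * y) * (x * y) = x * y := by rw [mul_mul_mul_comm, hx, hy]
  have e2 : ep (x * y) ≤ ep m := by
    rw [← e1, ep_mul_eb hxy mm']; exact inf_le_right
  rw [mm'] at mm
  have e3 : m = x := by
    refine eq_of_le mx ?_
    have : ep (x * y) = ep x := by rw [ep_mul_eb hx hy, inf_eq_left.2 h]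
    rwa [this] at e2
  exact e3 ▸ my

theorem idem_mul_le {x : R} (y : R) (hx : x * x = x) : x * y ≤ y := by
  have h : x * (y * y⁻¹) ≤ y * y⁻¹ := by
    refine idem_le_of_ep_le ?_ (eb_idem y) ?_
    · rw [mul_mul_mul_comm, hx, eb_idem]
    · rw [ep_mul_eb hx (eb_idem y)]; exact inf_le_right
  have h2 := qmul_le_mul_left y h
  rw [self_mul_eb, mul_left_comm, self_mul_eb] at h2
  exact h2

end directed

/-! ### The ring associated to a directed quasi-semiring -/

/-- The inverse limit of the groups `R_α = {x : e⁺ x = α}`, `α ∈ Λ₊`, with respect to the maps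
`x ↦ x + α`: the monotone sections `φ : Λ₊ → R` of `e⁺`. -/
structure LimRing (R : Type*) [CRQSRing R] where
  /-- the underlying map -/
  toFun : Pos (Lam R) → R
  ep_toFun : ∀ α, ep (toFun α) = (α : Lam R)
  mono' : ∀ α β, α ≤ β → toFun α ≤ toFun β

namespace LimRing

section add

variable {R : Type*} [CRQSRing R]

instance : CoeFun (LimRing R) (fun _ => Pos (Lam R) → R) := ⟨LimRing.toFun⟩

theorem ext {φ ψ : LimRing R} (h : ∀ α, φ α = ψ α) : φ = ψ := by
  cases φ; cases ψ; congr; exact funext h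

theorem ep_apply (φ : LimRing R) (α : Pos (Lam R)) : ep (φ α) = (α : Lam R) := φ.ep_toFun α

theorem mono (φ : LimRing R) {α β : Pos (Lam R)} (h : α ≤ β) : φ α ≤ φ β := φ.mono' α β h

theorem one_le (α : Pos (Lam R)) : (1 : Pos (Lam R)) ≤ α := α.2

theorem eq_add (φ : LimRing R) {α β : Pos (Lam R)} (h : α ≤ β) :
    φ α = φ β + ((α : Lam R) : R) := by
  have := φ.mono h
  rwa [le_iff, ep_apply] at this

/-- Pointwise addition. -/
instance : Add (LimRing R) where
  add φ ψ := ⟨fun α => φ α + ψ α, fun α => by rw [ep_add, ep_apply, ep_apply, inf_idem],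
    fun α β h => qadd_le_add (φ.mono h) (ψ.mono h)⟩

/-- The neutral element is the inclusion `Λ₊ → R`. -/
instance : Zero (LimRing R) where
  zero := ⟨fun α => ((α : Lam R) : R), fun α => ep_coe _, fun α β h => h⟩

/-- Pointwise negation. -/
instance : Neg (LimRing R) where
  neg φ := ⟨fun α => -φ α, fun α => by rw [ep_neg, ep_apply],
    fun α β h => qneg_le_neg (φ.mono h)⟩

instance : AddCommGroup (LimRing R) where
  add_assoc φ ψ χ := ext fun α => add_assoc (φ α) (ψ α) (χ α)
  add_comm φ ψ := ext fun α => add_comm (φ α) (ψ α)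
  zero_add φ := ext fun α => show ((α : Lam R) : R) + φ α = φ α by
    rw [add_comm]
    have := self_add_ep (φ α)
    rwa [ep_apply] at this
  add_zero φ := ext fun α => show φ α + ((α : Lam R) : R) = φ α by
    have := self_add_ep (φ α)
    rwa [ep_apply] at this
  neg_add_cancel φ := ext fun α => show -φ α + φ α = ((α : Lam R) : R) by
    rw [add_comm, ← coe_ep, ep_apply]
  nsmul := nsmulRec
  zsmul := zsmulRec

theorem add_apply (φ ψ : LimRing R) (α : Pos (Lam R)) : (φ + ψ) α = φ α + ψ α := rfl

theorem neg_apply (φ : LimRing R) (α : Pos (Lam R)) : (-φ) α = -φ α := rfl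

theorem zero_apply (α : Pos (Lam R)) : (0 : LimRing R) α = ((α : Lam R) : R) := rfl

/-- The element `v(φ(ε))⁻¹` of `Λ₊`. -/
def minus (φ : LimRing R) : Pos (Lam R) :=
  ⟨(v (φ 1))⁻¹, by
    have h := v_le_ep (φ 1)
    rw [ep_apply] at h
    exact one_le_inv'.2 h⟩

theorem coe_minus (φ : LimRing R) : (φ.minus : Lam R) = (v (φ 1))⁻¹ := rfl

theorem le_v_mul (φ : LimRing R) (α γ δ : Pos (Lam R)) (h : α * φ.minus ≤ γ) :
    (α : Lam R) ≤ v (φ δ) * γ := by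
  have h' : (α : Lam R) * (v (φ 1))⁻¹ ≤ γ := h
  calc (α : Lam R) = v (φ 1) * (α * (v (φ 1))⁻¹) := by rw [mul_left_comm]; simp
    _ ≤ v (φ δ) * γ := mul_le_mul' (v_mono (φ.mono (one_le δ))) h'

theorem le_ep_mul (φ ψ : LimRing R) (α γ δ : Pos (Lam R)) (h₁ : α * ψ.minus ≤ γ)
    (h₂ : α * φ.minus ≤ δ) : (α : Lam R) ≤ ep (φ γ * ψ δ) := by
  rw [ep_mul, ep_apply, ep_apply]
  exact le_inf (le_v_mul φ α δ γ h₂) (le_v_mul ψ α γ δ h₁)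

theorem mul_aux (φ ψ : LimRing R) (α γ δ : Pos (Lam R)) (h₁ : α * ψ.minus ≤ γ)
    (h₂ : α * φ.minus ≤ δ) :
    φ (α * ψ.minus) * ψ (α * φ.minus) + ((α : Lam R) : R) = φ γ * ψ δ + ((α : Lam R) : R) :=
  add_lam_eq (qmul_le_mul (φ.mono h₁) (ψ.mono h₂)) (le_ep_mul φ ψ α _ _ le_rfl le_rfl)

/-- The product `(φ ψ)(α) = φ(α v(ψ(ε))⁻¹) ψ(α v(φ(ε))⁻¹) + α`. -/
instance : Mul (LimRing R) where
  mul φ ψ := ⟨fun α => φ (α * ψ.minus) * ψ (α * φ.minus) + ((α : Lam R) : R),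
    fun α => by
      rw [ep_add, ep_coe, inf_eq_right]
      exact le_ep_mul φ ψ α _ _ le_rfl le_rfl,
    fun α β h => qadd_le_add (qmul_le_mul (φ.mono (mul_le_mul_left h _))
      (ψ.mono (mul_le_mul_left h _))) h⟩

theorem mul_apply (φ ψ : LimRing R) (α γ δ : Pos (Lam R)) (h₁ : α * ψ.minus ≤ γ)
    (h₂ : α * φ.minus ≤ δ) : (φ * ψ) α = φ γ * ψ δ + ((α : Lam R) : R) :=
  mul_aux φ ψ α γ δ h₁ h₂

theorem mul_apply_large (φ ψ : LimRing R) (α : Pos (Lam R)) :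
    ∃ γ₀ : Pos (Lam R), ∀ γ, γ₀ ≤ γ →
      (φ * ψ) α = φ γ * ψ γ + ((α : Lam R) : R) ∧ (α : Lam R) ≤ ep (φ γ * ψ γ) := by
  refine ⟨α * ψ.minus * φ.minus, fun γ h => ?_⟩
  have h₁ : α * ψ.minus ≤ γ := (le_mul_of_one_le_right' (one_le _)).trans h
  have h₂ : α * φ.minus ≤ γ := by
    rw [mul_right_comm] at h
    exact (le_mul_of_one_le_right' (one_le _)).trans h
  exact ⟨mul_apply φ ψ α γ γ h₁ h₂, le_ep_mul φ ψ α γ γ h₁ h₂⟩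

protected theorem mul_comm (φ ψ : LimRing R) : φ * ψ = ψ * φ := ext fun α => by
  obtain ⟨γ₁, h₁⟩ := mul_apply_large φ ψ α
  obtain ⟨γ₂, h₂⟩ := mul_apply_large ψ φ α
  rw [(h₁ (γ₁ * γ₂) (le_mul_of_one_le_right' (one_le _))).1,
    (h₂ (γ₁ * γ₂) (le_mul_of_one_le_left' (one_le _))).1, mul_comm (φ _)]

theorem mul_mul_apply_large (φ ψ χ : LimRing R) (α : Pos (Lam R)) :
    ∃ γ₀ : Pos (Lam R), ∀ γ, γ₀ ≤ γ →
      (φ * ψ * χ) α = φ γ * ψ γ * χ γ + ((α : Lam R) : R) := by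
  obtain ⟨η, hη⟩ := mul_apply_large (φ * ψ) χ α
  obtain ⟨δ, hδ⟩ := mul_apply_large φ ψ η
  refine ⟨η * δ, fun γ hγ => ?_⟩
  have hηγ : η ≤ γ := (le_mul_of_one_le_right' (one_le _)).trans hγ
  have hδγ : δ ≤ γ := (le_mul_of_one_le_left' (one_le _)).trans hγ
  obtain ⟨e, he⟩ := hη η le_rfl
  rw [e]
  refine add_lam_eq (qmul_le_mul ?_ (χ.mono hηγ)) he
  rw [(hδ γ hδγ).1]
  exact add_lam_le _ _

protected theorem mul_assoc (φ ψ χ : LimRing R) : φ * ψ * χ = φ * (ψ * χ) := ext fun α => by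
  obtain ⟨γ₁, h₁⟩ := mul_mul_apply_large φ ψ χ α
  obtain ⟨γ₂, h₂⟩ := mul_mul_apply_large ψ χ φ α
  rw [LimRing.mul_comm φ (ψ * χ), h₁ (γ₁ * γ₂) (le_mul_of_one_le_right' (one_le _)),
    h₂ (γ₁ * γ₂) (le_mul_of_one_le_left' (one_le _)), mul_assoc (φ _), mul_comm (φ _)]

protected theorem mul_add (φ ψ χ : LimRing R) : φ * (ψ + χ) = φ * ψ + φ * χ := ext fun α => by
  obtain ⟨γ₁, h₁⟩ := mul_apply_large φ ψ α
  obtain ⟨γ₂, h₂⟩ := mul_apply_large φ χ α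
  obtain ⟨γ₃, h₃⟩ := mul_apply_large φ (ψ + χ) α
  obtain ⟨e₁, f₁⟩ := h₁ (γ₁ * γ₂ * γ₃)
    ((le_mul_of_one_le_right' (one_le _)).trans (le_mul_of_one_le_right' (one_le _)))
  obtain ⟨e₂, f₂⟩ := h₂ (γ₁ * γ₂ * γ₃)
    ((le_mul_of_one_le_left' (one_le _)).trans (le_mul_of_one_le_right' (one_le _)))
  obtain ⟨e₃, f₃⟩ := h₃ (γ₁ * γ₂ * γ₃) (le_mul_of_one_le_left' (one_le _))
  rw [add_apply, e₁, e₂, e₃, add_add_add_comm, Lam.idem]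
  symm
  refine add_lam_eq (quasidistrib _ _ _) ?_
  rw [ep_add]
  exact le_inf f₁ f₂

/-- The associated map `w : B → Λ̂`, `w φ = v ∘ φ`. -/
def w (φ : LimRing R) : LHat (Lam R) :=
  ⟨fun α => v (φ α), fun α β h => by rw [φ.eq_add h, v_add_lam]⟩

theorem w_apply (φ : LimRing R) (α : Pos (Lam R)) : w φ α = v (φ α) := rfl

theorem w_add (φ ψ : LimRing R) : w φ ⊓ w ψ ≤ w (φ + ψ) := fun _ => v_add _ _

theorem w_zero : w (0 : LimRing R) = ⊤ := LHat.ext fun α => v_coe (α : Lam R)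

theorem w_neg (φ : LimRing R) : w (-φ) = w φ := LHat.ext fun _ => v_neg _

end add

section one

variable {R : Type*} [CRQSRing R] [IsSuperrigid R]

/-- The unique multiplicative idempotent `x` with `e⁺ x = α`. -/
noncomputable def unitAt (α : Pos (Lam R)) : R := (IsSuperrigid.exists_idem α).choose

theorem unitAt_mul_self (α : Pos (Lam R)) : unitAt α * unitAt α = unitAt α :=
  (IsSuperrigid.exists_idem α).choose_spec.1

theorem ep_unitAt (α : Pos (Lam R)) : ep (unitAt α) = (α : Lam R) :=
  (IsSuperrigid.exists_idem α).choose_spec.2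

/-- The ring structure; the unit sends `α` to the idempotent `unitAt α`. -/
noncomputable instance : CommRing (LimRing R) where
  __ := (inferInstance : AddCommGroup (LimRing R))
  mul_comm := LimRing.mul_comm
  mul_assoc := LimRing.mul_assoc
  left_distrib := LimRing.mul_add
  right_distrib φ ψ χ := by
    rw [LimRing.mul_comm, LimRing.mul_add, LimRing.mul_comm χ, LimRing.mul_comm χ]
  zero_mul φ := by
    have h := LimRing.mul_add φ 0 0
    rw [add_zero] at h
    rw [LimRing.mul_comm]
    exact left_eq_add.1 h
  mul_zero φ := by
    have h := LimRing.mul_add φ 0 0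
    rw [add_zero] at h
    exact left_eq_add.1 h
  one := ⟨unitAt, ep_unitAt, fun α β h => idem_le_of_ep_le (unitAt_mul_self α)
    (unitAt_mul_self β) (by rw [ep_unitAt, ep_unitAt]; exact h)⟩
  one_mul φ := ext fun α => by
    obtain ⟨γ, h⟩ := mul_apply_large ⟨unitAt, ep_unitAt, fun α β h => idem_le_of_ep_le
      (unitAt_mul_self α) (unitAt_mul_self β) (by rw [ep_unitAt, ep_unitAt]; exact h)⟩ φ α
    obtain ⟨e, f⟩ := h (γ * α) (le_mul_of_one_le_right' (one_le _))
    refine e.trans ?_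
    rw [φ.eq_add (show α ≤ γ * α from le_mul_of_one_le_left' (one_le _))]
    exact add_lam_eq (idem_mul_le _ (unitAt_mul_self _)) f
  mul_one φ := by
    rw [LimRing.mul_comm]
    exact ext fun α => by
      obtain ⟨γ, h⟩ := mul_apply_large ⟨unitAt, ep_unitAt, fun α β h => idem_le_of_ep_le
        (unitAt_mul_self α) (unitAt_mul_self β) (by rw [ep_unitAt, ep_unitAt]; exact h)⟩ φ α
      obtain ⟨e, f⟩ := h (γ * α) (le_mul_of_one_le_right' (one_le _))
      refine e.trans ?_
      rw [φ.eq_add (show α ≤ γ * α from le_mul_of_one_le_left' (one_le _))]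
      exact add_lam_eq (idem_mul_le _ (unitAt_mul_self _)) f

theorem one_apply (α : Pos (Lam R)) : (1 : LimRing R) α = unitAt α := rfl

theorem w_mul (φ ψ : LimRing R) : w (φ * ψ) = w φ * w ψ := LHat.ext fun α => by
  obtain ⟨γ₁, h₁⟩ := mul_apply_large φ ψ α
  obtain ⟨γ₂, -, h₂⟩ := LHat.mul_apply' (w φ) (w ψ) α
  rw [w_apply, (h₁ (γ₁ * γ₂) (le_mul_of_one_le_right' (one_le _))).1, v_add_lam,
    h₂ (γ₁ * γ₂) (le_mul_of_one_le_left' (one_le _)), v_mul]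
  rfl

theorem w_one : w (1 : LimRing R) = 1 := LHat.ext fun α => by
  rw [w_apply, one_apply, v_of_mul_idem (unitAt_mul_self α)]
  exact (inf_eq_left.2 α.2).symm

theorem LHat_mul_mono {Λ : Type*} [CommGroup Λ] [Lattice Λ] [IsOrderedMonoid Λ]
    {a b c : LHat Λ} (h : a ≤ b) : a * c ≤ b * c := fun α => by
  obtain ⟨γ₁, -, h₁⟩ := LHat.mul_apply' a c α
  obtain ⟨γ₂, -, h₂⟩ := LHat.mul_apply' b c α
  rw [h₁ (γ₁ * γ₂) (le_mul_of_one_le_right' (LHat.one_le _)),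
    h₂ (γ₁ * γ₂) (le_mul_of_one_le_left' (LHat.one_le _))]
  exact inf_le_inf_right _ (mul_le_mul_left (h _) _)

/-- The subring `A = {φ : 1 ≤ w φ}` of `B`. -/
def valuationSubring (R : Type*) [CRQSRing R] [IsSuperrigid R] : Subring (LimRing R) where
  carrier := {φ | 1 ≤ w φ}
  mul_mem' {φ ψ} (h₁ : 1 ≤ w φ) (h₂ : 1 ≤ w ψ) := show 1 ≤ w (φ * ψ) by
    rw [w_mul]
    refine h₂.trans ?_
    have := LHat_mul_mono (c := w ψ) h₁
    rwa [one_mul] at this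
  one_mem' := show 1 ≤ w (1 : LimRing R) by rw [w_one]
  add_mem' {φ ψ} (h₁ : 1 ≤ w φ) (h₂ : 1 ≤ w ψ) := (le_inf h₁ h₂).trans (w_add φ ψ)
  zero_mem' := show 1 ≤ w (0 : LimRing R) by rw [w_zero]; exact le_top
  neg_mem' {φ} (h : 1 ≤ w φ) := show 1 ≤ w (-φ) by rwa [w_neg]

end one

end LimRing

/-! ### Finitely generated submodules and Prüfer extensions -/

/-- The monoid `M(A, B)` of the finitely generated `A`-submodules of `B`. -/
def FGMod {B : Type*} [CommRing B] (A : Subring B) : Submonoid (Submodule A B) where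
  carrier := {I | I.FG}
  mul_mem' h₁ h₂ := h₁.mul h₂
  one_mem' := by
    show (1 : Submodule A B).FG
    rw [Submodule.one_eq_span]
    exact Submodule.fg_span_singleton _

/-- `A ⊆ B` is a Prüfer extension if every finitely generated `A`-submodule `I` of `B` which is
`B`-regular (i.e. `I B = B`) is invertible. -/
def IsPruferExt {B : Type*} [CommRing B] (A : Subring B) : Prop :=
  ∀ I : FGMod A, (I : Submodule A B) * ⊤ = ⊤ → IsUnit I

section value

variable {R : Type*} [CRQSRing R] [IsSuperrigid R]

open LimRing

theorem inf_w_le (s : Finset (LimRing R)) {φ : LimRing R}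
    (h : φ ∈ Submodule.span (valuationSubring R) (s : Set (LimRing R))) : s.inf w ≤ w φ := by
  induction h using Submodule.span_induction with
  | mem x hx => exact Finset.inf_le hx
  | zero => rw [w_zero]; exact le_top
  | add x y _ _ hx hy => exact (le_inf hx hy).trans (w_add x y)
  | smul a x _ hx =>
    have ha : 1 ≤ w (a : LimRing R) := a.2
    have h := LHat_mul_mono (c := w x) ha
    rw [one_mul, ← w_mul] at h
    exact hx.trans h

/-- The map `ŵ : M(A, B) → Λ̂` sending a finitely generated submodule to the meet of the values of
a system of generators. It does not depend on the choice of the system of generators, see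
`wHat_eq`. -/
noncomputable def wHat (I : FGMod (valuationSubring R)) : LHat (Lam R) :=
  (Classical.choose I.2 : Finset (LimRing R)).inf w

theorem wHat_eq (I : FGMod (valuationSubring R)) (s : Finset (LimRing R))
    (h : Submodule.span (valuationSubring R) (s : Set (LimRing R)) = I) :
    wHat I = s.inf w := by
  have h' : Submodule.span (valuationSubring R)
      ((Classical.choose I.2 : Finset (LimRing R)) : Set (LimRing R)) = I :=
    Classical.choose_spec I.2
  apply le_antisymm
  · refine Finset.le_inf fun x hx => inf_w_le _ ?_
    rw [h', ← h]; exact Submodule.subset_span hx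
  · refine Finset.le_inf fun x hx => inf_w_le _ ?_
    rw [h, ← h']; exact Submodule.subset_span hx

end value

/-- The group of those elements of the submonoid `ŵ(M)` of `Λ̂` that are invertible in it. -/
def valueUnits (R : Type*) [CRQSRing R] [IsSuperrigid R] : Set (LHat (Lam R)) :=
  {θ | θ ∈ Set.range (wHat (R := R)) ∧ ∃ ψ ∈ Set.range (wHat (R := R)), θ * ψ = 1}

/-- `R` is Prüfer if `A ⊆ B` is a Prüfer extension. -/
def IsPruferQS (R : Type*) [CRQSRing R] [IsSuperrigid R] : Prop :=
  IsPruferExt (LimRing.valuationSubring R)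

/-- `R` is Prüfer–Manis in the strong sense: it is Prüfer, the invertible elements of `ŵ(M)` are
exactly the elements of `Λ`, and `ŵ` induces an isomorphism of ordered groups from the group `M*`
of invertible finitely generated submodules (ordered by reverse inclusion) onto `Λ`. -/
def IsStronglyPruferManis (R : Type*) [CRQSRing R] [IsSuperrigid R] : Prop :=
  IsPruferQS R ∧
  valueUnits R = Set.range (LHat.embed : Lam R → LHat (Lam R)) ∧
  ∃ f : (FGMod (LimRing.valuationSubring R))ˣ ≃* Lam R,
    (∀ I : (FGMod (LimRing.valuationSubring R))ˣ,
      wHat (I : FGMod (LimRing.valuationSubring R)) = LHat.embed (f I)) ∧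
    ∀ I J : (FGMod (LimRing.valuationSubring R))ˣ, f I ≤ f J ↔
      ((J : FGMod (LimRing.valuationSubring R)) :
        Submodule (LimRing.valuationSubring R) (LimRing R)) ≤
      (I : FGMod (LimRing.valuationSubring R))

/-! ### Completeness and the metric structure -/

/-- `R` is (spherically) complete if through every element `x` there passes a monotone section of
`e⁺` defined on all of `Λ`. -/
def IsCompleteQS (R : Type*) [CRQSRing R] : Prop :=
  ∀ x : R, ∃ φ : Lam R → R, (∀ α, ep (φ α) = α) ∧ (∀ α β, α ≤ β → φ α ≤ φ β) ∧ φ (ep x) = x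

section metric

variable {R : Type*} [CRQSRing R] [IsDirectedQS R]

/-- The `Λ`-valued distance `d(x, y) = e⁺(x) e⁺(y) / e⁺(x ∧ y)²`. -/
def qdist (x y : R) : Lam R := ep x * ep y / ep (x ⊓ y) ^ 2

/-- The cell `[x, y]` of all `z ≥ x ∧ y` such that `z` is the join of `x ∧ z` and `y ∧ z`. -/
def cell (x y : R) : Set R := {z | x ⊓ y ≤ z ∧ IsLUB {x ⊓ z, y ⊓ z} z}

end metric

/-- `R` is locally faithfully full if all maps `d(x, -) : [x, y] → [1, d(x, y)]` are bijective. -/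
def IsLFF (R : Type*) [CRQSRing R] [IsDirectedQS R] : Prop :=
  ∀ x y : R, Set.BijOn (qdist x) (cell x y) (Set.Icc 1 (qdist x y))

/-- `R` is median if `[x, y] ∩ [y, z] ∩ [z, x]` consists of a single element for all `x, y, z`. -/
def IsMedianQS (R : Type*) [CRQSRing R] [IsDirectedQS R] : Prop :=
  ∀ x y z : R, ∃! u, u ∈ cell x y ∩ cell y z ∩ cell z x

end CRQ

/-!
Lifting elements of `R` to sections, which completeness permits, turns division in `R` into
approximate division in `B`: if `w φ ∧ δ ≤ w ψ` with `δ ∈ Λ`, then `ψ ∈ A φ + V δ`, where `V θ` is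
the `A`-module of all elements of value at least `θ`. Hence `I + V δ = V (ŵ I ∧ δ)` for every
finitely generated `I`. Since `V θ * V ζ ⊆ V (θ ζ)` and `V 1 = A`, an invertible `I` equals
`V (ŵ I)`, and a finitely generated `I` with `I B = B` contains some `V δ` and so equals
`V (ŵ I ∧ δ)`, where `ŵ I ∧ δ` lies in `Λ`. If all of `Λ` is attained on `M*`, this proves the
Prüfer–Manis property.

It also gives the Chinese remainder theorem `V γ + V δ = V (γ ∧ δ)`. Corrected by it, lifts of two
elements of `R` that agree on their common level become a single lift of both, so that compatible
elements of `R` have a join. This is equivalent to `R` being locally faithfully full, and the median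
of `x`, `y`, `z` is the join of their three pairwise meets.
-/

namespace CRQ

open Filter

section LatticeOrderedGroup

variable {Λ : Type*} [CommGroup Λ] [Lattice Λ] [IsOrderedMonoid Λ]

theorem inf_sup_left_of_isOrderedMonoid (a b c : Λ) : a ⊓ (b ⊔ c) = a ⊓ b ⊔ a ⊓ c :=
  letI := CommGroup.toDistribLattice Λ
  inf_sup_left a b c

theorem div_mul_div_inf_div_of_inf_eq {μ ξ π κ : Λ} (h : π ⊓ κ = μ) :
    ξ / π * (κ / μ) ⊓ ξ / μ = ξ / π := by
  rw [← div_mul_div_cancel ξ π μ, ← mul_inf, ← inf_div, inf_comm, h, div_self', mul_one]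

theorem eq_and_eq_of_div_mul_div_eq {μ ξ π κ π' κ' : Λ} (h : π ⊓ κ = μ) (h' : π' ⊓ κ' = μ)
    (he : ξ / π * (κ / μ) = ξ / π' * (κ' / μ)) : π = π' ∧ κ = κ' := by
  have hdiv : ξ / π = ξ / π' := by
    rw [← div_mul_div_inf_div_of_inf_eq h, he, div_mul_div_inf_div_of_inf_eq h']
  refine ⟨div_right_injective hdiv, ?_⟩
  rw [hdiv] at he
  exact div_left_injective (mul_left_cancel he)

theorem exists_inf_eq_and_div_mul_div_eq {μ ξ η γ : Λ} (hξ : μ ≤ ξ) (hη : μ ≤ η) (hγ : 1 ≤ γ)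
    (hγ' : γ ≤ ξ / μ * (η / μ)) :
    ∃ π ≤ ξ, ∃ κ ≤ η, π ⊓ κ = μ ∧ ξ / π * (κ / μ) = γ := by
  have hσ : 1 ≤ γ ⊓ ξ / μ := le_inf hγ (one_le_div'.2 hξ)
  refine ⟨ξ / (γ ⊓ ξ / μ), (div_le_self_iff _).2 hσ, γ * μ / (γ ⊓ ξ / μ), ?_, ?_, ?_⟩
  · rw [div_le_iff_le_mul, mul_inf]
    refine le_inf ?_ ?_
    · rw [mul_comm]
      exact mul_le_mul_left hη γ
    · calc γ * μ ≤ ξ / μ * (η / μ) * μ := mul_le_mul_left hγ' μ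
        _ = η * (ξ / μ) := by rw [mul_assoc, div_mul_cancel, mul_comm]
  · calc ξ / (γ ⊓ ξ / μ) ⊓ γ * μ / (γ ⊓ ξ / μ) = (ξ / μ ⊓ γ) * μ / (γ ⊓ ξ / μ) := by
          rw [← inf_div, inf_mul, div_mul_cancel]
      _ = μ := by rw [inf_comm, mul_div_cancel_left]
  · rw [div_div_cancel, div_right_comm, mul_div_cancel_right, mul_div_cancel]

end LatticeOrderedGroup

namespace LHat

variable {Λ : Type*} [CommGroup Λ] [Lattice Λ] [IsOrderedMonoid Λ]

instance : IsDirectedOrder (Pos Λ) :=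
  ⟨fun α β => ⟨α * β, le_mul_of_one_le_right' (one_le β), le_mul_of_one_le_left' (one_le α)⟩⟩

theorem eventually_le_coe (a : Λ) : ∀ᶠ α : Pos Λ in atTop, a ≤ α :=
  (eventually_ge_atTop (⟨a ⊔ 1, le_sup_right⟩ : Pos Λ)).mono fun _ h => le_sup_left.trans h

theorem eventually_mul_apply (θ ζ : LHat Λ) (α : Pos Λ) :
    ∀ᶠ γ in atTop, (θ * ζ) α = θ γ * ζ γ ⊓ (α : Λ) :=
  let ⟨γ, _, h⟩ := mul_apply' θ ζ α
  (eventually_ge_atTop γ).mono h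

instance : IsOrderedMonoid (LHat Λ) where
  mul_le_mul_left _ _ h _ := LimRing.LHat_mul_mono h

protected theorem inf_mul (θ ζ χ : LHat Λ) : (θ ⊓ ζ) * χ = θ * χ ⊓ ζ * χ := by
  refine ext fun α => ?_
  obtain ⟨γ, hθζ, hθ, hζ⟩ := ((eventually_mul_apply (θ ⊓ ζ) χ α).and
    ((eventually_mul_apply θ χ α).and (eventually_mul_apply ζ χ α))).exists
  rw [inf_apply, hθζ, hθ, hζ, inf_apply, inf_mul, inf_inf_distrib_right]

protected theorem top_mul (θ : LHat Λ) : ⊤ * θ = ⊤ := by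
  refine top_le_iff.1 fun α => ?_
  obtain ⟨γ, hmul, hγ⟩ :=
    ((eventually_mul_apply ⊤ θ α).and (eventually_le_coe ((α : Λ) / θ 1))).exists
  rw [hmul]
  exact le_inf ((div_le_iff_le_mul.1 hγ).trans (mul_le_mul_right (θ.mono (one_le γ)) _)) le_rfl

theorem finset_inf_mul {ι : Type*} (s : Finset ι) (f : ι → LHat Λ) (θ : LHat Λ) :
    s.inf f * θ = s.inf fun i => f i * θ :=
  Finset.apply_inf_eq_inf_comp (· * θ) (fun a b => LHat.inf_mul a b θ) (LHat.top_mul θ)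

theorem finset_mul_inf {ι : Type*} (s : Finset ι) (f : ι → LHat Λ) (θ : LHat Λ) :
    θ * s.inf f = s.inf fun i => θ * f i := by
  simp only [mul_comm θ, finset_inf_mul]

theorem embed_apply (γ : Λ) (α : Pos Λ) : embed γ α = γ ⊓ (α : Λ) := rfl

theorem embed_one : (embed 1 : LHat Λ) = 1 := rfl

theorem embed_le_iff {γ : Λ} {θ : LHat Λ} : embed γ ≤ θ ↔ ∃ α, γ ≤ θ α := by
  constructor
  · intro h
    obtain ⟨α, hα⟩ := (eventually_le_coe γ).exists
    exact ⟨α, (le_inf le_rfl hα).trans (h α)⟩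
  · rintro ⟨α, hα⟩ β
    obtain ⟨δ, hαδ, hβδ⟩ := exists_ge_ge α β
    rw [θ.compat hβδ]
    exact inf_le_inf_right _ (hα.trans (θ.mono hαδ))

theorem embed_le_embed {γ δ : Λ} : embed γ ≤ embed δ ↔ γ ≤ δ :=
  ⟨fun h => let ⟨_, hα⟩ := embed_le_iff.1 h; hα.trans inf_le_left,
    fun h _ => inf_le_inf_right _ h⟩

theorem embed_injective : Function.Injective (embed : Λ → LHat Λ) := fun _ _ h =>
  le_antisymm (embed_le_embed.1 h.le) (embed_le_embed.1 h.ge)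

theorem embed_inf (γ δ : Λ) : embed (γ ⊓ δ) = embed γ ⊓ embed δ :=
  ext fun _ => inf_inf_distrib_right _ _ _

theorem embed_mul (γ δ : Λ) : embed (γ * δ) = embed γ * embed δ := by
  refine ext fun α => ?_
  obtain ⟨η, hmul, hγ, hδ⟩ := ((eventually_mul_apply (embed γ) (embed δ) α).and
    ((eventually_le_coe γ).and (eventually_le_coe δ))).exists
  rw [hmul, embed_apply, embed_apply, embed_apply, inf_eq_left.2 hγ, inf_eq_left.2 hδ]

theorem embed_apply_inf (θ : LHat Λ) {δ : Λ} {α : Pos Λ} (h : δ ≤ α) :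
    embed (θ α ⊓ δ) = θ ⊓ embed δ := by
  refine ext fun β => ?_
  obtain ⟨γ, hα, hβ⟩ := exists_ge_ge α β
  calc θ α ⊓ δ ⊓ β = θ γ ⊓ (α ⊓ δ) ⊓ β := by rw [θ.compat hα, inf_assoc (θ γ)]
    _ = θ γ ⊓ β ⊓ (δ ⊓ β) := by rw [inf_eq_right.2 h, inf_inf_distrib_right]
    _ = θ β ⊓ (δ ⊓ β) := by rw [← θ.compat hβ]

theorem exists_embed_eq_of_le {θ : LHat Λ} {δ : Λ} (h : θ ≤ embed δ) : ∃ γ, embed γ = θ :=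
  let ⟨_, hα⟩ := (eventually_le_coe δ).exists
  ⟨_, (embed_apply_inf θ hα).trans (inf_eq_left.2 h)⟩

theorem exists_one_le_embed_mul (θ : LHat Λ) : ∃ δ, 1 ≤ embed δ * θ := by
  refine ⟨(θ 1)⁻¹, ?_⟩
  calc 1 = embed (θ 1)⁻¹ * embed (θ 1) := by rw [← embed_mul, inv_mul_cancel, embed_one]
    _ ≤ embed (θ 1)⁻¹ * θ := mul_le_mul_right (embed_le_iff.2 ⟨1, le_rfl⟩) _

theorem exists_embed_eq_of_mul_eq_one {θ ζ : LHat Λ} (h : θ * ζ = 1) : ∃ γ, embed γ = θ := by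
  obtain ⟨δ, hδ⟩ := exists_one_le_embed_mul ζ
  refine exists_embed_eq_of_le (δ := δ) ?_
  calc θ ≤ θ * (embed δ * ζ) := le_mul_of_one_le_right' hδ
    _ = embed δ := by rw [mul_left_comm, h, mul_one]

end LHat

section Truncation

variable {R : Type*} [CRQSRing R]

theorem eq_of_le_of_le_of_ep_eq {x y z : R} (hx : x ≤ z) (hy : y ≤ z) (h : ep x = ep y) :
    x = y := by
  rw [le_iff.1 hx, le_iff.1 hy, h]

theorem ep_add_coe_of_le {x : R} {α : Lam R} (h : α ≤ ep x) : ep (x + (α : R)) = α := by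
  rw [ep_add, ep_coe, inf_eq_right.2 h]

theorem le_add_coe {x z : R} {α : Lam R} (h : x ≤ z) (hα : ep x ≤ α) : x ≤ z + (α : R) := by
  rw [← self_add_ep x]
  exact qadd_le_add h hα

theorem ep_eq_sup_of_isLUB {x y z : R} (h : IsLUB {x, y} z) : ep z = ep x ⊔ ep y := by
  have hx : x ≤ z := h.1 (Set.mem_insert _ _)
  have hy : y ≤ z := h.1 (Set.mem_insert_of_mem _ rfl)
  refine le_antisymm ?_ (sup_le (ep_mono hx) (ep_mono hy))
  have hz : z ≤ z + ((ep x ⊔ ep y : Lam R) : R) := by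
    refine h.2 ?_
    rintro _ (rfl | rfl)
    exacts [le_add_coe hx le_sup_left, le_add_coe hy le_sup_right]
  refine (ep_mono hz).trans ?_
  rw [ep_add, ep_coe]
  exact inf_le_right

end Truncation

section Join

variable {R : Type*} [CRQSRing R] [IsDirectedQS R]

theorem v_add_neg_eq_ep_inf (x y : R) : v (x + -y) = ep (x ⊓ y) := by
  rw [inf_def, ep_add_coe_of_le]
  exact (v_le_ep _).trans ((ep_add x (-y)).trans_le inf_le_left)

theorem mul_inv_mul_cancel_of_v_le {x y : R} (he : ep x = ep y) (hv : v x ≤ v y) :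
    x * (x⁻¹ * y) = y := by
  rw [← mul_assoc]
  refine eq_of_le (idem_mul_le y (eb_idem x)) ?_
  rw [ep_mul, v_eb, one_mul]
  refine le_inf le_rfl ?_
  rw [← he, ep_eq x]
  exact mul_le_mul_left hv _

theorem ep_inf_of_le {x y z : R} (hx : x ≤ z) (hy : y ≤ z) : ep (x ⊓ y) = ep x ⊓ ep y := by
  refine le_antisymm (le_inf (ep_mono inf_le_left) (ep_mono inf_le_right)) ?_
  have hz : ep x ⊓ ep y ≤ ep z := inf_le_left.trans (ep_mono hx)
  rw [← ep_add_coe_of_le hz, Lam.coe_inf, ← add_assoc, ← le_iff.1 hx]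
  refine ep_mono (le_inf (add_lam_le _ _) ?_)
  rw [le_iff.1 hx, add_right_comm, ← le_iff.1 hy]
  exact add_lam_le _ _

theorem isLUB_of_ep_eq_sup {x y z : R} (hx : x ≤ z) (hy : y ≤ z) (he : ep z = ep x ⊔ ep y) :
    IsLUB {x, y} z := by
  refine ⟨?_, fun t ht => ?_⟩
  · rintro _ (rfl | rfl)
    exacts [hx, hy]
  · have hxt : x ≤ z ⊓ t := le_inf hx (ht (Set.mem_insert _ _))
    have hyt : y ≤ z ⊓ t := le_inf hy (ht (Set.mem_insert_of_mem _ rfl))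
    have hzt : z ⊓ t = z :=
      eq_of_le inf_le_left (he.trans_le (sup_le (ep_mono hxt) (ep_mono hyt)))
    exact inf_eq_left.1 hzt

theorem isLUB_add_ep_sup_ep {x y z : R} (hx : x ≤ z) (hy : y ≤ z) :
    IsLUB {x, y} (z + ((ep x ⊔ ep y : Lam R) : R)) :=
  isLUB_of_ep_eq_sup (le_add_coe hx le_sup_left) (le_add_coe hy le_sup_right)
    (ep_add_coe_of_le (sup_le (ep_mono hx) (ep_mono hy)))

theorem isLUB_inf_inf_of_le {x y z t : R} (h : IsLUB {x, y} z) (ht : t ≤ z) :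
    IsLUB {t ⊓ x, t ⊓ y} t := by
  refine isLUB_of_ep_eq_sup inf_le_left inf_le_left ?_
  rw [ep_inf_of_le ht (h.1 (Set.mem_insert _ _)),
    ep_inf_of_le ht (h.1 (Set.mem_insert_of_mem _ rfl)), ← inf_sup_left_of_isOrderedMonoid,
    ← ep_eq_sup_of_isLUB h, inf_eq_left.2 (ep_mono ht)]

theorem inf_eq_of_isLUB {p q x z : R} (h : IsLUB {p, q} z) (hp : p ≤ x) (hq : x ⊓ q ≤ p) :
    x ⊓ z = p := by
  refine le_antisymm ((isLUB_inf_inf_of_le h inf_le_right).2 ?_)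
    (le_inf hp (h.1 (Set.mem_insert _ _)))
  rintro _ (rfl | rfl)
  exacts [inf_le_right, (inf_le_inf_right _ inf_le_left).trans hq]

/-- Any two compatible elements have a join. Elements `x` and `y` are compatible if their
truncations to the common level `e⁺ x ∧ e⁺ y` agree, which is encoded as
`e⁺ (x ∧ y) = e⁺ x ∧ e⁺ y`. -/
def HasCompatibleJoins (R : Type*) [CRQSRing R] [IsDirectedQS R] : Prop :=
  ∀ x y : R, ep (x ⊓ y) = ep x ⊓ ep y → ∃ z, IsLUB {x, y} z

theorem HasCompatibleJoins.exists_isLUB_triple (hj : HasCompatibleJoins R) {a b c : R}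
    (hab : ep (a ⊓ b) = ep a ⊓ ep b) (hac : ep (a ⊓ c) = ep a ⊓ ep c)
    (hbc : ep (b ⊓ c) = ep b ⊓ ep c) : ∃ u, IsLUB {a, b, c} u := by
  obtain ⟨j, hbcj⟩ := hj b c hbc
  obtain ⟨u, hu⟩ := hj a j <| by
    refine le_antisymm (le_inf (ep_mono inf_le_left) (ep_mono inf_le_right)) ?_
    rw [ep_eq_sup_of_isLUB hbcj, inf_sup_left_of_isOrderedMonoid, ← hab, ← hac]
    exact sup_le (ep_mono (inf_le_inf_left a (hbcj.1 (Set.mem_insert _ _))))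
      (ep_mono (inf_le_inf_left a (hbcj.1 (Set.mem_insert_of_mem _ rfl))))
  refine ⟨u, ?_⟩
  rw [IsLUB, upperBounds_insert, upperBounds_singleton] at hu
  rwa [IsLUB, upperBounds_insert, hbcj.upperBounds_eq]

end Join

section Cell

variable {R : Type*} [CRQSRing R] [IsDirectedQS R] {x y z : R}

theorem ep_inf_inf_ep_inf_of_mem_cell (h : z ∈ cell x y) :
    ep (x ⊓ z) ⊓ ep (y ⊓ z) = ep (x ⊓ y) := by
  rw [← ep_inf_of_le inf_le_right inf_le_right, ← inf_inf_distrib_right, inf_eq_left.2 h.1]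

theorem qdist_eq_div_mul_div (x y : R) :
    qdist x y = ep x / ep (x ⊓ y) * (ep y / ep (x ⊓ y)) := by
  rw [qdist, div_mul_div_comm, sq]

theorem qdist_eq_of_mem_cell (h : z ∈ cell x y) :
    qdist x z = ep x / ep (x ⊓ z) * (ep (y ⊓ z) / ep (x ⊓ y)) := by
  have hz : ep (x ⊓ y) * ep z = ep (x ⊓ z) * ep (y ⊓ z) := by
    rw [← ep_inf_inf_ep_inf_of_mem_cell h, ep_eq_sup_of_isLUB h.2, inf_mul_sup]
  rw [qdist_eq_div_mul_div, mul_right_inj, div_eq_div_iff_mul_eq_mul, mul_comm, hz, mul_comm]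

theorem qdist_mem_Icc_of_mem_cell (h : z ∈ cell x y) : qdist x z ∈ Set.Icc 1 (qdist x y) := by
  have hμ := ep_inf_inf_ep_inf_of_mem_cell h
  have hx : ep (x ⊓ y) ≤ ep (x ⊓ z) := hμ ▸ inf_le_left
  have hy : ep (x ⊓ y) ≤ ep (y ⊓ z) := hμ ▸ inf_le_right
  rw [Set.mem_Icc, qdist_eq_of_mem_cell h, qdist_eq_div_mul_div]
  exact ⟨one_le_mul (one_le_div'.2 (ep_mono inf_le_left)) (one_le_div'.2 hy),
    mul_le_mul' (div_le_div_left' hx _) (div_le_div_right' (ep_mono inf_le_left) _)⟩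

theorem injOn_qdist_cell (x y : R) : Set.InjOn (qdist x) (cell x y) := by
  intro z hz z' hz' h
  rw [qdist_eq_of_mem_cell hz, qdist_eq_of_mem_cell hz'] at h
  obtain ⟨hx, hy⟩ := eq_and_eq_of_div_mul_div_eq (ep_inf_inf_ep_inf_of_mem_cell hz)
    (ep_inf_inf_ep_inf_of_mem_cell hz') h
  have hlub := hz.2
  rw [eq_of_le_of_le_of_ep_eq inf_le_left inf_le_left hx,
    eq_of_le_of_le_of_ep_eq inf_le_left inf_le_left hy] at hlub
  exact hlub.unique hz'.2

theorem HasCompatibleJoins.exists_mem_cell (hj : HasCompatibleJoins R) {π κ : Lam R}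
    (hπ : π ≤ ep x) (hκ : κ ≤ ep y) (h : π ⊓ κ = ep (x ⊓ y)) :
    ∃ z ∈ cell x y, ep (x ⊓ z) = π ∧ ep (y ⊓ z) = κ := by
  obtain ⟨p, hp⟩ : ∃ p, p = x + (π : R) := ⟨_, rfl⟩
  obtain ⟨q, hq⟩ : ∃ q, q = y + (κ : R) := ⟨_, rfl⟩
  have ep_p : ep p = π := hp ▸ ep_add_coe_of_le hπ
  have ep_q : ep q = κ := hq ▸ ep_add_coe_of_le hκ
  have hpx : p ≤ x := hp ▸ add_lam_le x π
  have hqy : q ≤ y := hq ▸ add_lam_le y κ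
  have hxyp : x ⊓ y ≤ p := hp ▸ le_add_coe inf_le_left (h ▸ inf_le_left)
  have hxyq : x ⊓ y ≤ q := hq ▸ le_add_coe inf_le_right (h ▸ inf_le_right)
  have hpq : p ⊓ q = x ⊓ y := le_antisymm (inf_le_inf hpx hqy) (le_inf hxyp hxyq)
  obtain ⟨z, hz⟩ := hj p q (by rw [hpq, ep_p, ep_q, h])
  have hxz : x ⊓ z = p := inf_eq_of_isLUB hz hpx ((inf_le_inf_left x hqy).trans hxyp)
  have hyz : y ⊓ z = q := inf_eq_of_isLUB (Set.pair_comm p q ▸ hz) hqy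
    ((inf_le_inf_left y hpx).trans (inf_comm y x ▸ hxyq))
  exact ⟨z, ⟨hxyp.trans (hz.1 (Set.mem_insert _ _)), by rwa [hxz, hyz]⟩, by rw [hxz, ep_p],
    by rw [hyz, ep_q]⟩

theorem HasCompatibleJoins.isLFF (hj : HasCompatibleJoins R) : IsLFF R := by
  refine fun x y => ⟨fun z hz => qdist_mem_Icc_of_mem_cell hz, injOn_qdist_cell x y,
    fun γ hγ => ?_⟩
  rw [Set.mem_Icc, qdist_eq_div_mul_div] at hγ
  obtain ⟨π, hπ, κ, hκ, hμ, rfl⟩ := exists_inf_eq_and_div_mul_div_eq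
    (ep_mono (inf_le_left : x ⊓ y ≤ x)) (ep_mono (inf_le_right : x ⊓ y ≤ y)) hγ.1 hγ.2
  obtain ⟨z, hz, rfl, rfl⟩ := hj.exists_mem_cell hπ hκ hμ
  exact ⟨z, hz, qdist_eq_of_mem_cell hz⟩

theorem IsLFF.hasCompatibleJoins (h : IsLFF R) : HasCompatibleJoins R := by
  intro x y hxy
  have hx : ep (x ⊓ y) ≤ ep x := ep_mono inf_le_left
  have hy : ep (x ⊓ y) ≤ ep y := ep_mono inf_le_right
  -- The join is the point of the cell at distance `e⁺ y / e⁺ (x ∧ y)` from `x`.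
  obtain ⟨z, hz, hdist⟩ : ∃ z ∈ cell x y, qdist x z = ep y / ep (x ⊓ y) := by
    refine (h x y).surjOn ⟨one_le_div'.2 hy, ?_⟩
    rw [qdist_eq_div_mul_div]
    exact le_mul_of_one_le_left' (one_le_div'.2 hx)
  rw [qdist_eq_of_mem_cell hz, ← one_mul (ep y / _), ← div_self' (ep x)] at hdist
  obtain ⟨hxz, hyz⟩ :=
    eq_and_eq_of_div_mul_div_eq (ep_inf_inf_ep_inf_of_mem_cell hz) hxy.symm hdist
  have hlub := hz.2
  rw [eq_of_le inf_le_left hxz.ge, eq_of_le inf_le_left hyz.ge] at hlub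
  exact ⟨z, hlub⟩

end Cell

section Median

variable {R : Type*} [CRQSRing R] [IsDirectedQS R] {x y z u : R}

theorem mem_cell_of_isLUB_meets (h : IsLUB {x ⊓ y, y ⊓ z, z ⊓ x} u) : u ∈ cell x y := by
  have hxy : x ⊓ y ≤ u := h.1 (by simp)
  have hyz : y ⊓ z ≤ u := h.1 (by simp)
  have hzx : z ⊓ x ≤ u := h.1 (by simp)
  refine ⟨hxy, ?_, fun t ht => h.2 ?_⟩
  · rintro _ (rfl | rfl) <;> exact inf_le_right
  · have hxt : x ⊓ u ≤ t := ht (Set.mem_insert _ _)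
    have hyt : y ⊓ u ≤ t := ht (Set.mem_insert_of_mem _ rfl)
    rintro _ (rfl | rfl | rfl)
    exacts [(le_inf inf_le_left hxy).trans hxt, (le_inf inf_le_left hyz).trans hyt,
      (le_inf inf_le_right hzx).trans hxt]

theorem isLUB_meets_of_mem_cells (hxy : u ∈ cell x y) (hyz : u ∈ cell y z)
    (hzx : u ∈ cell z x) : IsLUB {x ⊓ y, y ⊓ z, z ⊓ x} u := by
  refine ⟨?_, fun t ht => hxy.2.2 ?_⟩
  · rintro _ (rfl | rfl | rfl)
    exacts [hxy.1, hyz.1, hzx.1]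
  have hxyt : x ⊓ y ≤ t := ht (by simp)
  have hyzt : y ⊓ z ≤ t := ht (by simp)
  have hzxt : z ⊓ x ≤ t := ht (by simp)
  rintro _ (rfl | rfl)
  · refine (isLUB_inf_inf_of_le hyz.2 inf_le_right).2 ?_
    rintro _ (rfl | rfl)
    exacts [(inf_le_inf inf_le_left inf_le_left).trans hxyt,
      (inf_le_inf inf_le_left inf_le_left).trans (inf_comm x z ▸ hzxt)]
  · refine (isLUB_inf_inf_of_le hzx.2 inf_le_right).2 ?_
    rintro _ (rfl | rfl)
    exacts [(inf_le_inf inf_le_left inf_le_left).trans hyzt,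
      (inf_le_inf inf_le_left inf_le_left).trans (inf_comm y x ▸ hxyt)]

theorem HasCompatibleJoins.isMedianQS (hj : HasCompatibleJoins R) : IsMedianQS R := by
  intro x y z
  obtain ⟨u, hu⟩ : ∃ u, IsLUB {x ⊓ y, y ⊓ z, z ⊓ x} u :=
    hj.exists_isLUB_triple (ep_inf_of_le inf_le_right inf_le_left)
      (ep_inf_of_le inf_le_left inf_le_right) (ep_inf_of_le inf_le_right inf_le_left)
  have rotate : ∀ a b c : R, ({a, b, c} : Set R) = {b, c, a} := fun a b c => by
    rw [Set.insert_comm, Set.pair_comm]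
  refine ⟨u, ⟨⟨mem_cell_of_isLUB_meets hu, ?_⟩, ?_⟩, ?_⟩
  · exact mem_cell_of_isLUB_meets (rotate _ _ _ ▸ hu)
  · exact mem_cell_of_isLUB_meets (rotate _ _ _ ▸ rotate _ _ _ ▸ hu)
  · rintro t ⟨⟨hxy, hyz⟩, hzx⟩
    exact (isLUB_meets_of_mem_cells hxy hyz hzx).unique hu

theorem IsLFF.isMedianQS (h : IsLFF R) : IsMedianQS R :=
  h.hasCompatibleJoins.isMedianQS

end Median

namespace LimRing

section Lifts

variable {R : Type*} [CRQSRing R] {φ ψ : LimRing R} {x y : R}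

/-- The section `φ` lifts `x` if `x` is a truncation of `φ`, that is, if `x` lies below some
value of `φ`. -/
def Lifts (φ : LimRing R) (x : R) : Prop := ∃ α, x ≤ φ α

theorem Lifts.eventually (h : φ.Lifts x) : ∀ᶠ α in atTop, x ≤ φ α :=
  let ⟨α, hα⟩ := h
  (eventually_ge_atTop α).mono fun _ hβ => hα.trans (φ.mono hβ)

theorem Lifts.add (hx : φ.Lifts x) (hy : ψ.Lifts y) : (φ + ψ).Lifts (x + y) :=
  let ⟨α, hα⟩ := (hx.eventually.and hy.eventually).exists
  ⟨α, qadd_le_add hα.1 hα.2⟩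

theorem Lifts.neg (hx : φ.Lifts x) : (-φ).Lifts (-x) :=
  hx.imp fun _ => qneg_le_neg

theorem Lifts.sub (hx : φ.Lifts x) (hy : ψ.Lifts y) : (φ - ψ).Lifts (x + -y) :=
  sub_eq_add_neg φ ψ ▸ hx.add hy.neg

theorem eventually_mul_apply (φ ψ : LimRing R) (α : Pos (Lam R)) :
    ∀ᶠ γ in atTop, (φ * ψ) α = φ γ * ψ γ + ((α : Lam R) : R) :=
  let ⟨γ, hγ⟩ := mul_apply_large φ ψ α
  (eventually_ge_atTop γ).mono fun _ h => (hγ _ h).1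

theorem Lifts.mul (hx : φ.Lifts x) (hy : ψ.Lifts y) : (φ * ψ).Lifts (x * y) := by
  obtain ⟨α, hα⟩ := (LHat.eventually_le_coe (ep (x * y))).exists
  obtain ⟨γ, hγ, hxγ, hyγ⟩ :=
    ((eventually_mul_apply φ ψ α).and (hx.eventually.and hy.eventually)).exists
  exact ⟨α, hγ ▸ le_add_coe (qmul_le_mul hxγ hyγ) hα⟩

theorem exists_lifts (hc : IsCompleteQS R) (x : R) : ∃ φ : LimRing R, φ.Lifts x := by
  obtain ⟨f, hep, hmono, hfx⟩ := hc x
  obtain ⟨α, hα⟩ := (LHat.eventually_le_coe (ep x)).exists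
  exact ⟨⟨fun β => f β, fun β => hep β, fun β γ h => hmono β γ h⟩, α,
    hfx.symm.trans_le (hmono _ _ hα)⟩

theorem exists_lifts_ep_eq (φ : LimRing R) (δ : Lam R) :
    ∃ x, φ.Lifts x ∧ ep x = δ ∧ LHat.embed (v x) = w φ ⊓ LHat.embed δ := by
  obtain ⟨α, hα⟩ := (LHat.eventually_le_coe δ).exists
  have hδ : δ ≤ ep (φ α) := hα.trans_eq (φ.ep_apply α).symm
  refine ⟨φ α + (δ : R), ⟨α, add_lam_le _ _⟩, ep_add_coe_of_le hδ, ?_⟩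
  rw [v_add_lam, ← w_apply, LHat.embed_apply_inf _ hα]

variable [IsDirectedQS R]

theorem lifts_coe_iff {γ : Lam R} : φ.Lifts (γ : R) ↔ LHat.embed γ ≤ w φ := by
  refine (exists_congr fun α => ⟨fun h => ?_, fun h => ?_⟩).trans LHat.embed_le_iff.symm
  · exact (v_coe γ).symm.trans_le (v_mono h)
  · exact (Lam.coe_le.2 h).trans (v_le (φ α))

theorem Lifts.embed_v_le (h : φ.Lifts x) : LHat.embed (v x) ≤ w φ :=
  lifts_coe_iff.1 (h.imp fun _ => (v_le x).trans)

theorem Lifts.add_of_embed_ep_le_w (hx : φ.Lifts x) (h : LHat.embed (ep x) ≤ w ψ) :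
    (φ + ψ).Lifts x :=
  self_add_ep x ▸ hx.add (lifts_coe_iff.2 h)

theorem exists_embed_le_w_sub_mul (hc : IsCompleteQS R) {δ : Lam R}
    (h : w φ ⊓ LHat.embed δ ≤ w ψ) : ∃ χ, 1 ≤ w χ ∧ LHat.embed δ ≤ w (ψ - χ * φ) := by
  obtain ⟨x, hφx, hx, hvx⟩ := exists_lifts_ep_eq φ δ
  obtain ⟨y, hψy, hy, hvy⟩ := exists_lifts_ep_eq ψ δ
  have hv : v x ≤ v y := by
    rw [← LHat.embed_le_embed, hvx, hvy]
    exact le_inf h inf_le_right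
  obtain ⟨χ, hχ⟩ := exists_lifts hc (x⁻¹ * y)
  refine ⟨χ, ?_, ?_⟩
  · rw [← LHat.embed_one]
    refine le_trans (LHat.embed_le_embed.2 ?_) hχ.embed_v_le
    rwa [v_mul, v_inv, ← div_eq_inv_mul, one_le_div']
  · have hχφ : (χ * φ).Lifts y := by
      rw [LimRing.mul_comm, ← mul_inv_mul_cancel_of_v_le (hx.trans hy.symm) hv]
      exact hφx.mul hχ
    rw [← hy, ← lifts_coe_iff]
    exact hψy.sub hχφ

end Lifts

end LimRing

section ValSubmodule

open LimRing

variable {R : Type*} [CRQSRing R] [IsSuperrigid R]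

/-- The `A`-module of all elements of `B` of value at least `θ`. -/
def valSubmodule (θ : LHat (Lam R)) : Submodule (valuationSubring R) (LimRing R) where
  carrier := {φ | θ ≤ w φ}
  add_mem' hφ hψ := (le_inf hφ hψ).trans (w_add _ _)
  zero_mem' := le_top.trans_eq w_zero.symm
  smul_mem' a φ hφ :=
    hφ.trans <| (le_mul_of_one_le_left' a.2).trans_eq (w_mul (a : LimRing R) φ).symm

variable {θ ζ : LHat (Lam R)}

theorem mem_valSubmodule {φ : LimRing R} : φ ∈ valSubmodule θ ↔ θ ≤ w φ := Iff.rfl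

theorem valSubmodule_anti (h : θ ≤ ζ) : valSubmodule ζ ≤ valSubmodule θ := fun _ => h.trans

theorem valSubmodule_mul_le : valSubmodule θ * valSubmodule ζ ≤ valSubmodule (θ * ζ) :=
  Submodule.mul_le.2 fun φ hφ ψ hψ => (mul_le_mul' hφ hψ).trans_eq (w_mul φ ψ).symm

theorem valSubmodule_one_le : valSubmodule (1 : LHat (Lam R)) ≤ 1 := fun φ hφ =>
  Submodule.mem_one.2 ⟨⟨φ, hφ⟩, rfl⟩

theorem valSubmodule_le_of_one_le_mul {I J : Submodule (valuationSubring R) (LimRing R)}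
    (h : 1 ≤ I * J) (hJ : J ≤ valSubmodule ζ) (hθ : 1 ≤ θ * ζ) : valSubmodule θ ≤ I :=
  calc valSubmodule θ ≤ I * J * valSubmodule θ := le_mul_of_one_le_left' h
    _ = I * (valSubmodule θ * J) := by rw [mul_assoc, mul_comm J]
    _ ≤ I * 1 := mul_le_mul_right ((mul_le_mul_right hJ _).trans <|
        valSubmodule_mul_le.trans <| (valSubmodule_anti hθ).trans valSubmodule_one_le) I
    _ = I := mul_one I

theorem span_le_valSubmodule_iff {s : Finset (LimRing R)} :
    Submodule.span (valuationSubring R) s ≤ valSubmodule θ ↔ θ ≤ s.inf w := by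
  rw [Submodule.span_le, Finset.le_inf_iff]
  rfl

theorem span_singleton_sup_valSubmodule (hc : IsCompleteQS R) (φ : LimRing R) (δ : Lam R) :
    Submodule.span (valuationSubring R) {φ} ⊔ valSubmodule (LHat.embed δ) =
      valSubmodule (w φ ⊓ LHat.embed δ) := by
  refine le_antisymm (sup_le ?_ (valSubmodule_anti inf_le_right)) fun ψ hψ => ?_
  · rw [Submodule.span_singleton_le_iff_mem, mem_valSubmodule]
    exact inf_le_left
  · obtain ⟨χ, hχ, hψχ⟩ := exists_embed_le_w_sub_mul hc hψ
    exact Submodule.mem_sup.2 ⟨χ * φ, Submodule.mem_span_singleton.2 ⟨⟨χ, hχ⟩, rfl⟩, ψ - χ * φ,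
      hψχ, add_sub_cancel _ _⟩

theorem span_sup_valSubmodule (hc : IsCompleteQS R) (s : Finset (LimRing R)) (δ : Lam R) :
    Submodule.span (valuationSubring R) s ⊔ valSubmodule (LHat.embed δ) =
      valSubmodule (s.inf w ⊓ LHat.embed δ) := by
  classical
  induction s using Finset.induction_on with
  | empty =>
    rw [Finset.coe_empty, Submodule.span_empty, bot_sup_eq, Finset.inf_empty, top_inf_eq]
  | insert φ s _ ih =>
    obtain ⟨γ, hγ⟩ := LHat.exists_embed_eq_of_le
      (inf_le_right : s.inf w ⊓ LHat.embed δ ≤ LHat.embed δ)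
    rw [Finset.coe_insert, Submodule.span_insert, sup_assoc, ih, ← hγ,
      span_singleton_sup_valSubmodule hc, hγ, Finset.inf_insert, inf_assoc]

theorem le_valSubmodule_iff {I : FGMod (valuationSubring R)} :
    (I : Submodule (valuationSubring R) (LimRing R)) ≤ valSubmodule θ ↔ θ ≤ wHat I := by
  obtain ⟨s, hs⟩ := I.2
  rw [wHat_eq I s hs, ← hs, span_le_valSubmodule_iff]

theorem sup_valSubmodule (hc : IsCompleteQS R) (I : FGMod (valuationSubring R)) (δ : Lam R) :
    (I : Submodule (valuationSubring R) (LimRing R)) ⊔ valSubmodule (LHat.embed δ) =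
      valSubmodule (wHat I ⊓ LHat.embed δ) := by
  obtain ⟨s, hs⟩ := I.2
  rw [wHat_eq I s hs, ← hs, span_sup_valSubmodule hc]

theorem exists_valSubmodule_embed_le {I : Submodule (valuationSubring R) (LimRing R)}
    (h : I * ⊤ = ⊤) : ∃ δ : Lam R, valSubmodule (LHat.embed δ) ≤ I := by
  have hone : (1 : LimRing R) ∈ I * ⊤ := by
    rw [h]
    exact Submodule.mem_top
  obtain ⟨s, t, hs, -, hst⟩ := Submodule.mem_span_mul_finite_of_mem_mul hone
  rw [← Submodule.span_mul_span, ← Submodule.one_le] at hst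
  obtain ⟨δ, hδ⟩ := LHat.exists_one_le_embed_mul (t.inf w)
  have hle : (1 : Submodule (valuationSubring R) (LimRing R)) ≤
      I * Submodule.span (valuationSubring R) t :=
    hst.trans (mul_le_mul_left (Submodule.span_le.2 hs) _)
  exact ⟨δ, valSubmodule_le_of_one_le_mul hle (span_le_valSubmodule_iff.2 le_rfl) hδ⟩

end ValSubmodule

section UnitValue

open LimRing
open scoped Pointwise

variable {R : Type*} [CRQSRing R] [IsSuperrigid R]

theorem wHat_one : wHat (1 : FGMod (valuationSubring R)) = 1 := by
  rw [wHat_eq 1 {1} (by rw [Finset.coe_singleton, ← Submodule.one_eq_span]; rfl),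
    Finset.inf_singleton, w_one]

theorem wHat_mul (I J : FGMod (valuationSubring R)) : wHat (I * J) = wHat I * wHat J := by
  classical
  obtain ⟨s, hs⟩ := I.2
  obtain ⟨t, ht⟩ := J.2
  have hst : Submodule.span (valuationSubring R) ((s * t : Finset (LimRing R)) : Set (LimRing R)) =
      (I * J : FGMod (valuationSubring R)) := by
    rw [Finset.coe_mul, ← Submodule.span_mul_span, hs, ht, Submonoid.coe_mul]
  rw [wHat_eq I s hs, wHat_eq J t ht, wHat_eq (I * J) (s * t) hst, Finset.inf_mul_left,
    LHat.finset_inf_mul]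
  simp only [w_mul, LHat.finset_mul_inf]

/-- The group `M*` of the invertible finitely generated `A`-submodules of `B`. -/
abbrev InvertibleModule (R : Type*) [CRQSRing R] [IsSuperrigid R] : Type _ :=
  (FGMod (valuationSubring R))ˣ

theorem wHat_mul_wHat_inv (I : InvertibleModule R) :
    wHat I.val * wHat (I⁻¹ : InvertibleModule R).val = 1 := by
  rw [← wHat_mul, Units.mul_inv, wHat_one]

theorem exists_embed_eq_wHat (I : InvertibleModule R) : ∃ γ, LHat.embed γ = wHat I.val :=
  LHat.exists_embed_eq_of_mul_eq_one (wHat_mul_wHat_inv I)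

/-- The homomorphism `M* → Λ` induced by `ŵ`, see `embed_unitValue`. -/
noncomputable def unitValue : InvertibleModule R →* Lam R :=
  MonoidHom.mk' (fun I => (exists_embed_eq_wHat I).choose) fun I J => LHat.embed_injective <| by
    rw [LHat.embed_mul, (exists_embed_eq_wHat I).choose_spec,
      (exists_embed_eq_wHat J).choose_spec, (exists_embed_eq_wHat (I * J)).choose_spec,
      Units.val_mul, wHat_mul]

theorem embed_unitValue (I : InvertibleModule R) : LHat.embed (unitValue I) = wHat I.val :=
  (exists_embed_eq_wHat I).choose_spec

theorem coe_eq_valSubmodule (I : InvertibleModule R) :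
    (I.val : Submodule (valuationSubring R) (LimRing R)) =
      valSubmodule (LHat.embed (unitValue I)) := by
  have hinv : (I.val : Submodule (valuationSubring R) (LimRing R)) *
      (I⁻¹ : InvertibleModule R).val = 1 := congrArg Subtype.val I.mul_inv
  rw [embed_unitValue]
  exact le_antisymm (le_valSubmodule_iff.2 le_rfl) <|
    valSubmodule_le_of_one_le_mul hinv.ge (le_valSubmodule_iff.2 le_rfl) (wHat_mul_wHat_inv I).ge

theorem unitValue_le_unitValue_iff {I J : InvertibleModule R} :
    unitValue I ≤ unitValue J ↔
      (J.val : Submodule (valuationSubring R) (LimRing R)) ≤ I.val := by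
  rw [coe_eq_valSubmodule I, le_valSubmodule_iff, ← embed_unitValue, LHat.embed_le_embed]

theorem unitValue_injective : Function.Injective (unitValue : InvertibleModule R → Lam R) :=
  fun I J h => Units.ext <| Subtype.ext <| by rw [coe_eq_valSubmodule, h, ← coe_eq_valSubmodule]

theorem isPruferQS (hc : IsCompleteQS R)
    (hsurj : Function.Surjective (unitValue : InvertibleModule R → Lam R)) : IsPruferQS R := by
  intro I hI
  obtain ⟨δ, hδ⟩ := exists_valSubmodule_embed_le hI
  obtain ⟨γ, hγ⟩ := LHat.exists_embed_eq_of_le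
    (inf_le_right : wHat I ⊓ LHat.embed δ ≤ LHat.embed δ)
  obtain ⟨J, rfl⟩ := hsurj γ
  refine ⟨J, Subtype.ext ?_⟩
  rw [coe_eq_valSubmodule, hγ, ← sup_valSubmodule hc, sup_eq_left.2 hδ]

theorem valueUnits_eq (hsurj : Function.Surjective (unitValue : InvertibleModule R → Lam R)) :
    valueUnits R = Set.range (LHat.embed : Lam R → LHat (Lam R)) := by
  refine Set.Subset.antisymm ?_ ?_
  · rintro θ ⟨-, ζ, -, h⟩
    exact LHat.exists_embed_eq_of_mul_eq_one h
  · rintro _ ⟨γ, rfl⟩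
    obtain ⟨I, rfl⟩ := hsurj γ
    rw [embed_unitValue]
    exact ⟨⟨I.val, rfl⟩, _, ⟨_, rfl⟩, wHat_mul_wHat_inv I⟩

theorem isStronglyPruferManis (hc : IsCompleteQS R)
    (hsurj : Function.Surjective (unitValue : InvertibleModule R → Lam R)) :
    IsStronglyPruferManis R :=
  ⟨isPruferQS hc hsurj, valueUnits_eq hsurj,
    MulEquiv.ofBijective unitValue ⟨unitValue_injective, hsurj⟩,
    fun I => (embed_unitValue I).symm, fun _ _ => unitValue_le_unitValue_iff⟩

theorem valSubmodule_sup_valSubmodule (hc : IsCompleteQS R)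
    (hsurj : Function.Surjective (unitValue : InvertibleModule R → Lam R)) (γ δ : Lam R) :
    valSubmodule (LHat.embed γ) ⊔ valSubmodule (LHat.embed δ) =
      valSubmodule (LHat.embed (γ ⊓ δ)) := by
  obtain ⟨I, rfl⟩ := hsurj γ
  rw [← coe_eq_valSubmodule, sup_valSubmodule hc, LHat.embed_inf, embed_unitValue]

theorem hasCompatibleJoins (hc : IsCompleteQS R)
    (hsurj : Function.Surjective (unitValue : InvertibleModule R → Lam R)) :
    HasCompatibleJoins R := by
  intro x y hxy
  obtain ⟨φ, hφ⟩ := exists_lifts hc x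
  obtain ⟨ψ, hψ⟩ := exists_lifts hc y
  have hsub : φ - ψ ∈ valSubmodule (LHat.embed (ep x ⊓ ep y)) := by
    rw [mem_valSubmodule, ← hxy, ← v_add_neg_eq_ep_inf]
    exact (hφ.sub hψ).embed_v_le
  rw [← valSubmodule_sup_valSubmodule hc hsurj] at hsub
  obtain ⟨a, ha, b, hb, hab⟩ := Submodule.mem_sup.1 hsub
  have hχx : (φ + -a).Lifts x := hφ.add_of_embed_ep_le_w (ha.trans_eq (w_neg a).symm)
  have hχy : (φ + -a).Lifts y := by
    have hχ : φ + -a = ψ + b := by linear_combination -hab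
    exact hχ ▸ hψ.add_of_embed_ep_le_w hb
  obtain ⟨α, hx, hy⟩ := (hχx.eventually.and hχy.eventually).exists
  exact ⟨_, isLUB_add_ep_sup_ep hx hy⟩

end UnitValue

end CRQ

theorem lemma6p11 (R : Type*) [CRQ.CRQSRing R] [CRQ.IsSuperrigid R]
    (hcomplete : CRQ.IsCompleteQS R)
    (honto : ∀ γ : CRQ.Lam R, ∃ I : (CRQ.FGMod (CRQ.LimRing.valuationSubring R))ˣ,
      CRQ.wHat (I : CRQ.FGMod (CRQ.LimRing.valuationSubring R)) = CRQ.LHat.embed γ) :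
    CRQ.IsStronglyPruferManis R ∧ CRQ.IsLFF R ∧ CRQ.IsMedianQS R := by
  have hsurj : Function.Surjective (CRQ.unitValue : CRQ.InvertibleModule R → CRQ.Lam R) :=
    fun γ => (honto γ).imp fun I hI => CRQ.LHat.embed_injective ((CRQ.embed_unitValue I).trans hI)
  have hlff : CRQ.IsLFF R := (CRQ.hasCompatibleJoins hcomplete hsurj).isLFF
  exact ⟨CRQ.isStronglyPruferManis hcomplete hsurj, hlff, hlff.isMedianQS⟩
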